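/- **Setting.** Consider the massless Wess–Zumino model in four Euclidean dimensions: a chiral multiplet (scalar, chiral fermion, auxiliary field) with cubic interactions. At each vertex the three lines carry either one auxiliary field and two scalars, or two fermions and one scalar. Every massless propagator joins a chiral vertex to an antichiral vertex. It is $1/p^2$ times a numerator, which is $1$ for the scalar, $\slash\mkern-9mu p$ for the fermion and $p^2$ for the auxiliary field. Let $K$ be a connected cubic bipartite graph, with classes the chiral and antichiral vertices (parallel edges are allowed). The completions of primitive propagator graphs are special cases. Assign to the edges momenta $p_e\in\mathbb R^4$ that are conserved at every vertex. For an edge $e=(a,b)$, regard $K$ as the completion, by the added link $e$, of the propagator graph $K\setminus e$ with external legs at $a$ and $b$. For a component $X$ of the multiplet, the field assignments of the two-point function of $X$ on $K\setminus e$ are the assignments of components to all edges of $K$ that obey the rule above at every vertex and in which $e$ carries $X$. The weight of an assignment is $$\prod_{e'\neq e\ \text{auxiliary}}p_{e'}^2\ \prod_{\text{fermion loops }C\not\ni e}\bigl(-\operatorname{Tr}(P\,\slash\mkern-9mu p_{1}\cdots\slash\mkern-9mu p_{n})\bigr),$$ where $p_1,\dots,p_n$ are the successive momenta along $C$, all oriented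 in the direction of travel, starting at any vertex, and $P=\frac12(1\pm\gamma_5)$ is the projector attached to the chirality of this vertex. If $X$ is the fermion, the weight is further multiplied by the open line $P_a\,\slash\mkern-9mu q_1\cdots\slash\mkern-9mu q_m$, where $q_1,\dots,q_m$ are the successive momenta on the fermion line from $a$ to $b$ and $P_a$ is the projector attached to $a$. Let $N^X_e(p)$ be the sum of these weights over all assignments of the two-point function of $X$, and let $N_e$ be $N^X_e$ for $X$ the auxiliary field (in this case all neighbours of $e$ are scalar links). The integrands of all three two-point functions have the same denominator $\prod_{e'\ne e}p_{e'}^2$. **Theorem.** 1. (Completion independence.) For all conserved momenta $p$ and all edges $e,e'$ of $K$, $N_e(p)=N_{e'}(p)$. 2. (No vertex subdivergences.) Let $\gamma$ be a vertex subgraph: the subgraph induced by a set of at least two vertices of $K$, connected, with exactly three edges of $K$ joining it to its complement. Let $E_\gamma$ be its number of edges and $L_\gamma$ its number of loops. Then for every edge $e$ of $K$ the summed numerator $N_e$, as a polynomial in the loop momenta of $\gamma$, has degree at most some $D$ with $$4L_\gamma+D-2E_\gamma<0,$$ that is, $\gamma$ is superficially ultraviolet convergent. 3. (Supersymmetry at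 the integrand level.) For all conserved momenta and every edge $e=(a,b)$ of $K$, with either end taken as $a$, and with $p_{b,a}$ the momentum carried by $e$ from $b$ to $a$, $$N^{\rm scalar}_e=p_{b,a}^2\,N_e,\qquad N^{\rm fermion}_e=N_e\;P_a\,\slash\mkern-9mu p_{b,a}.$$ Hence the ratios of the two-point functions of the three components to their free counterparts $1,\ \slash\mkern-9mu p,\ p^2$ agree. -/

import Mathlib

namespace WessZumino

open scoped Matrix

/-! ### Euclidean Dirac matrices in four dimensions (chiral representation) -/

/-- Euclidean four-momenta. -/
abbrev Momentum : Type := Fin 4 → ℝ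

/-- Four-component spinor matrices, written in two by two blocks. -/
abbrev SpinorMatrix : Type := Matrix (Fin 2 ⊕ Fin 2) (Fin 2 ⊕ Fin 2) ℂ

/-- `i` times the Pauli matrices for `μ = 1, 2, 3`, and the identity for `μ = 0`. -/
noncomputable def weyl : Fin 4 → Matrix (Fin 2) (Fin 2) ℂ :=
  ![1, !![0, Complex.I; Complex.I, 0], !![0, 1; -1, 0], !![Complex.I, 0; 0, -Complex.I]]

/-- The hermitian Dirac matrices, `γ μ * γ ν + γ ν * γ μ = 2 δ μ ν`. -/
noncomputable def gamma (μ : Fin 4) : SpinorMatrix :=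
  Matrix.fromBlocks 0 (weyl μ) (weyl μ)ᴴ 0

/-- The Feynman slash of `p`. -/
noncomputable def slash (p : Momentum) : SpinorMatrix :=
  ∑ μ, (p μ : ℂ) • gamma μ

noncomputable def gammaFive : SpinorMatrix :=
  gamma 0 * gamma 1 * gamma 2 * gamma 3

/-- The chiral projector `(1 + γ₅) / 2` (for `true`) or `(1 - γ₅) / 2` (for `false`). -/
noncomputable def proj (s : Bool) : SpinorMatrix :=
  (1 / 2 : ℂ) • (1 + (if s then gammaFive else -gammaFive))

/-! ### Completed graphs -/

/-- The three components of the chiral multiplet that an edge can carry: the scalar (numerator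
`1`), the fermion (numerator `slash p`) and the auxiliary field (numerator `p ^ 2`), over the
common denominator `p ^ 2`. -/
inductive Component : Type
  | scalar
  | fermion
  | auxiliary

noncomputable instance : DecidableEq Component := Classical.decEq _

noncomputable instance : Fintype Component :=
  ⟨{Component.scalar, Component.fermion, Component.auxiliary}, by rintro (_ | _ | _) <;> simp⟩

/-- A completed (vacuum) graph of the massless model. Each massless propagator joins a chiral
vertex (`true`) to an antichiral vertex (`false`) and the interaction is cubic, so this is a
connected cubic bipartite graph; parallel edges are allowed. `ends s e` is the end of the edge `e`
which has chirality `s`. -/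
structure CompletedGraph (V E : Type*) where
  chirality : V → Bool
  ends : Bool → E → V
  chirality_ends : ∀ s e, chirality (ends s e) = s
  cubic : ∀ v, {e | ends (chirality v) e = v}.ncard = 3
  connected : (SimpleGraph.fromRel fun u v => ∃ e, ends true e = u ∧ ends false e = v).Connected

namespace CompletedGraph

variable {V E : Type*} [Fintype E] (K : CompletedGraph V E)

/-- The underlying simple graph (parallel edges are merged). -/
def skeleton : SimpleGraph V :=
  SimpleGraph.fromRel fun u v => ∃ e, K.ends true e = u ∧ K.ends false e = v

open Classical in
/-- The edges that meet the vertex `v`. -/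
noncomputable def incident (v : V) : Finset E :=
  Finset.univ.filter fun e => K.ends (K.chirality v) e = v

/-- Momentum conservation at all vertices. The momentum `p e` is counted from the chiral
to the antichiral end of `e`. -/
def IsFlow (p : E → Momentum) : Prop :=
  ∀ v, ∑ e ∈ K.incident v, p e = 0

/-- The field assignments allowed by the two interactions of the model: at each vertex,
the three lines are either one auxiliary field and two scalars, or two fermions and one scalar. -/
def IsAssignment (f : E → Component) : Prop :=
  ∀ v, (K.incident v).val.map f = {.auxiliary, .scalar, .scalar} ∨
    (K.incident v).val.map f = {.fermion, .fermion, .scalar}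

/-! #### Fermion lines -/

/-- A directed edge `(e, s)`: the edge `e`, traversed from its end of chirality `s`
to its end of chirality `!s`. -/
abbrev Dart (E : Type*) : Type _ := E × Bool

/-- The momentum that flows along a directed edge. -/
def dartMomentum (p : E → Momentum) (d : Dart E) : Momentum :=
  if d.2 then p d.1 else -p d.1

open Classical in
/-- The other fermionic edge at the end of chirality `s` of the fermionic edge `e`
(it is unique in a field assignment). -/
noncomputable def partner (f : E → Component) (s : Bool) (e : E) : E :=
  if h : ∃ e', e' ≠ e ∧ f e' = .fermion ∧ K.ends s e' = K.ends s e then h.choose else e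

/-- The directed edge which follows `d` on its fermion line. -/
noncomputable def next (f : E → Component) (d : Dart E) : Dart E :=
  (K.partner f (!d.2) d.1, !d.2)

/-- The number of edges of the fermion loop through `d`. -/
noncomputable def loopLength (f : E → Component) (d : Dart E) : ℕ :=
  Function.minimalPeriod (K.next f) d

/-- The ordered product of the slashed momenta on `n` successive directed edges of a fermion line,
of which `d` is the first one. -/
noncomputable def lineProduct (f : E → Component) (p : E → Momentum) (d : Dart E) (n : ℕ) :
    SpinorMatrix :=
  ((List.range n).map fun i => slash (dartMomentum p ((K.next f)^[i] d))).prod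

/-- The chiral trace on the fermion loop through `d`, where the chirality of the spinors is
tied to the chirality of the vertices. -/
noncomputable def loopTrace (f : E → Component) (p : E → Momentum) (d : Dart E) : ℂ :=
  (proj d.2 * K.lineProduct f p d (K.loopLength f d)).trace

open Classical in
/-- The set of edges of the fermion loop through `e`. -/
noncomputable def loopOf (f : E → Component) (e : E) : Finset E :=
  Finset.univ.filter fun e' => ∃ n : ℕ, ((K.next f)^[n] (e, true)).1 = e'

open Classical in
/-- The fermion loops of a field assignment, each given by its set of edges. -/
noncomputable def loops (f : E → Component) : Finset (Finset E) :=
  (Finset.univ.filter fun e => f e = .fermion).image (K.loopOf f)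

open Classical in
/-- The factor of a fermion loop: minus the chiral trace on this loop. By cyclicity, and because
the chiral trace is the same for both directions, the choice of the first edge is
irrelevant. -/
noncomputable def loopFactor (f : E → Component) (p : E → Momentum) (C : Finset E) : ℂ :=
  if h : C.Nonempty then -K.loopTrace f p (h.choose, true) else 1

open Classical in
/-- The scalar factors of the numerator of a field assignment, with `e` as the added link: `p ^ 2`
for each edge other than `e` with the auxiliary field, and the factor of each fermion
loop which does not use `e`. -/
noncomputable def weight (e : E) (f : E → Component) (p : E → Momentum) : ℂ :=
  (∏ e' with e' ≠ e ∧ f e' = .auxiliary, ((p e' ⬝ᵥ p e' : ℝ) : ℂ)) *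
    ∏ C ∈ K.loops f with e ∉ C, K.loopFactor f p C

open Classical in
/-- The field assignments in which the added link `e` has the given component: they are
the contributions to the two-point function of this component on the graph with `e` removed,
the two external legs being attached at the ends of `e`. -/
noncomputable def assignments (e : E) (c : Component) : Finset (E → Component) :=
  Finset.univ.filter fun f => K.IsAssignment f ∧ f e = c

/-- The summed numerator of the completed graph with added link `e`, that is, of the
two-point function of the auxiliary field (all neighbours of `e` are then scalars). -/
noncomputable def numerator (e : E) (p : E → Momentum) : ℂ :=
  ∑ f ∈ K.assignments e .auxiliary, K.weight e f p

/-- The summed numerator of the two-point function of the scalar field. -/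
noncomputable def scalarNumerator (e : E) (p : E → Momentum) : ℂ :=
  ∑ f ∈ K.assignments e .scalar, K.weight e f p

/-- The open fermion line from the end of chirality `s` of `e` to its other end:
the fermion loop through `e`, from which `e` itself is removed. -/
noncomputable def openLine (e : E) (s : Bool) (f : E → Component) (p : E → Momentum) :
    SpinorMatrix :=
  proj s * K.lineProduct f p (K.next f (e, !s)) (K.loopLength f (e, !s) - 1)

/-- The summed numerator of the two-point function of the fermion, from the end of
chirality `s` of `e` to its other end. -/
noncomputable def fermionNumerator (e : E) (s : Bool) (p : E → Momentum) : SpinorMatrix :=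
  ∑ f ∈ K.assignments e .fermion, K.weight e f p • K.openLine e s f p

/-! #### Power counting for vertex subgraphs -/

open Classical in
/-- The edges with both ends in `W`. -/
noncomputable def inner (W : Finset V) : Finset E :=
  Finset.univ.filter fun e => K.ends true e ∈ W ∧ K.ends false e ∈ W

open Classical in
/-- The edges with exactly one end in `W`. -/
noncomputable def boundary (W : Finset V) : Finset E :=
  Finset.univ.filter fun e => ¬ (K.ends true e ∈ W ↔ K.ends false e ∈ W)

/-- The vertices `W` span a (nontrivial) vertex subgraph: it is connected, has more than one
vertex and exactly three external legs. -/
def IsVertexSubgraph (W : Finset V) : Prop :=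
  2 ≤ W.card ∧ (K.skeleton.induce (W : Set V)).Connected ∧ (K.boundary W).card = 3

/-- The number of independent loops of the connected subgraph spanned by `W`. -/
noncomputable def loopNumber (W : Finset V) : ℤ :=
  (K.inner W).card - W.card + 1

/-- As a polynomial in the loop momenta of the subgraph spanned by `W`, the numerator `N` has
degree at most `D`. -/
def LoopDegreeLE (W : Finset V) (N : (E → Momentum) → ℂ) (D : ℕ) : Prop :=
  ∀ p k : E → Momentum, K.IsFlow p → K.IsFlow k → (∀ e, e ∉ K.inner W → k e = 0) →
    ∃ P : Polynomial ℂ, P.natDegree ≤ D ∧ ∀ t : ℝ, P.eval (t : ℂ) = N (p + t • k)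

/-- The subgraph spanned by `W` is superficially ultraviolet convergent for the numerator `N`
over the product of all `p ^ 2`: its superficial degree of divergence is negative. -/
def IsUVConvergent (W : Finset V) (N : (E → Momentum) → ℂ) : Prop :=
  ∃ D : ℕ, K.LoopDegreeLE W N D ∧ 4 * K.loopNumber W + D - 2 * (K.inner W).card < 0

end CompletedGraph

end WessZumino

/-! ### Momenta as quaternions, chirality and charge conjugation -/

namespace WessZumino
open scoped Matrix
open Matrix

/-! A Euclidean momentum is a quaternion, a two by two matrix `quat p` of determinant p². The
central fact (`sum_fullWeight_eq_det`) is that the numerators of all field assignments, with no edge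
removed, add up to the determinant of a chiral Dirac matrix D(p), whose block at a chiral and an
antichiral vertex is the sum of `quat` over the edges joining them. A Leibniz term with all entries
expanded into edges selects two edges, with multiplicity, at every vertex. An edge selected twice is
auxiliary, selected once fermionic, never selected scalar, and this reproduces exactly the two
interactions. The terms of one assignment add up to p² for each auxiliary edge and minus a chiral
trace for each fermion loop. To treat both alike, an auxiliary edge is handled as a fermion loop of
length two; the resulting factor 2 per auxiliary edge appears on both sides and is cancelled.

The determinant formula does not need momentum conservation. For conserved p the blocks of every row
and column of D(p) sum to zero, and a block matrix tree theorem (`det_add_singleBlock`) shows that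
all block cofactors have one common value M. Replacing the momentum on an edge e by an arbitrary X
adds a single block `quat (X - p e)`, so the determinant becomes (X - p_e)² M. Sorting the
assignments by the field on e, the same determinant is S - Tr(F X̸) + X² N, up to the direction of
X, where the numerators S, F, N of the three two-point functions do not contain p_e. Comparing the
two polynomials in X gives N = M, S = p_e² M and, by nondegeneracy of the trace pairing, the formula
for F (`numerators_eq`). As M does not refer to e, completion independence follows.

For power counting, one chirality is in the minority in a vertex subgraph, with n vertices. The loop
momenta occupy only its block rows or columns, and the cofactor can be taken at one of these, which
leaves degree at most 2(n - 1). With 3n edges and n loops the degree of divergence is at most -2. -/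

theorem trace_fromBlocks' (A B C D : Matrix (Fin 2) (Fin 2) ℂ) :
    (fromBlocks A B C D).trace = A.trace + D.trace := by
  simp [Matrix.trace]

/-- The two by two block of `slash p` that maps antichiral to chiral spinors. -/
noncomputable def quat (p : Momentum) : Matrix (Fin 2) (Fin 2) ℂ :=
  ∑ μ, (p μ : ℂ) • weyl μ

theorem quat_eq (p : Momentum) :
    quat p = !![(p 0 : ℂ) + p 3 * Complex.I, p 2 + p 1 * Complex.I;
      -p 2 + p 1 * Complex.I, p 0 - p 3 * Complex.I] := by
  ext i j
  fin_cases i <;> fin_cases j <;>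
    simp [quat, weyl, Fin.sum_univ_four] <;> ring

theorem quat_add (p q : Momentum) : quat (p + q) = quat p + quat q := by
  simp [quat, add_smul, Finset.sum_add_distrib]

theorem quat_smul (t : ℝ) (p : Momentum) : quat (t • p) = (t : ℂ) • quat p := by
  simp [quat, mul_smul, Finset.smul_sum]

/-- `quat` as an additive homomorphism. -/
noncomputable def quatHom : Momentum →+ Matrix (Fin 2) (Fin 2) ℂ where
  toFun := quat
  map_zero' := by simp [quat]
  map_add' := quat_add

theorem quat_zero : quat 0 = 0 := map_zero quatHom

theorem quat_sum {α : Type*} (s : Finset α) (p : α → Momentum) :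
    quat (∑ a ∈ s, p a) = ∑ a ∈ s, quat (p a) := map_sum quatHom p s

/-- For real p the hermitian conjugate is quaternion conjugation. The adjugate form has entries
equal, up to sign and position, to those of `quat p`, so it can be matched with the terms of a
determinant. -/
theorem quat_adjugate (p : Momentum) : (quat p)ᴴ = (quat p).adjugate := by
  rw [quat_eq, adjugate_fin_two_of]
  ext i j
  fin_cases i <;> fin_cases j <;> simp [conjTranspose_apply] <;> ring

theorem quat_det (p : Momentum) : (quat p).det = ((p ⬝ᵥ p : ℝ) : ℂ) := by
  rw [quat_eq, det_fin_two_of]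
  simp only [dotProduct, Fin.sum_univ_four]
  push_cast
  linear_combination (-(p 3 : ℂ) ^ 2 - (p 1 : ℂ) ^ 2) * Complex.I_sq

theorem slash_eq (p : Momentum) : slash p = fromBlocks 0 (quat p) (quat p).adjugate 0 := by
  rw [← quat_adjugate]
  ext (i | i) (j | j) <;> simp [slash, gamma, quat, Matrix.sum_apply, conjTranspose_apply]

theorem gammaFive_eq : gammaFive = fromBlocks 1 0 0 (-1) := by
  have hI : Complex.I * Complex.I = -1 := Complex.I_mul_I
  simp only [gammaFive, gamma, fromBlocks_multiply]
  ext (i | i) (j | j) <;> fin_cases i <;> fin_cases j <;>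
    simp [weyl, Matrix.mul_apply, conjTranspose_apply, Fin.sum_univ_two, Matrix.vecMul,
      dotProduct]

theorem proj_true : proj true = fromBlocks 1 0 0 0 := by
  rw [proj, if_pos rfl, gammaFive_eq, ← fromBlocks_one, fromBlocks_add, fromBlocks_smul]
  congr 1 <;> ext i j <;> fin_cases i <;> fin_cases j <;> simp <;> norm_num

theorem proj_false : proj false = fromBlocks 0 0 0 1 := by
  rw [proj, if_neg (by simp), gammaFive_eq, ← fromBlocks_one, fromBlocks_neg, fromBlocks_add,
    fromBlocks_smul]
  congr 1 <;> ext i j <;> fin_cases i <;> fin_cases j <;> simp <;> norm_num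

theorem proj_mul_slash (s : Bool) (p : Momentum) : proj s * slash p = slash p * proj (!s) := by
  cases s <;> simp [proj_true, proj_false, slash_eq, fromBlocks_multiply]

theorem proj_mul_self (s : Bool) : proj s * proj s = proj s := by
  cases s <;> simp [proj_true, proj_false, fromBlocks_multiply]

theorem slash_neg (p : Momentum) : slash (-p) = -slash p := by
  simp [slash, Finset.sum_neg_distrib]

/-- The charge conjugation matrix. -/
noncomputable def chargeConj : SpinorMatrix :=
  fromBlocks !![0, 1; -1, 0] 0 0 !![0, 1; -1, 0]

theorem chargeConj_mul_neg : chargeConj * -chargeConj = 1 := by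
  rw [chargeConj, fromBlocks_neg, fromBlocks_multiply, ← fromBlocks_one]
  congr 1 <;> ext i j <;> fin_cases i <;> fin_cases j <;> simp

/-- In this representation charge conjugation intertwines transposition with no sign, so that
transposing a product of slashed momenta merely reverses its order. -/
theorem slash_transpose (p : Momentum) :
    (slash p)ᵀ * chargeConj = chargeConj * slash p := by
  rw [slash_eq, fromBlocks_transpose, chargeConj, fromBlocks_multiply, fromBlocks_multiply,
    quat_eq, adjugate_fin_two_of]
  congr 1 <;> ext i j <;> fin_cases i <;> fin_cases j <;>
    simp [Matrix.mul_apply, Fin.sum_univ_two]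

theorem proj_transpose (s : Bool) : (proj s)ᵀ * chargeConj = chargeConj * proj s := by
  cases s <;> simp [proj_true, proj_false, fromBlocks_transpose, chargeConj, fromBlocks_multiply]

theorem list_prod_transpose_mul_chargeConj (l : List SpinorMatrix)
    (hl : ∀ a ∈ l, aᵀ * chargeConj = chargeConj * a) :
    l.prodᵀ * chargeConj = chargeConj * l.reverse.prod := by
  induction l with
  | nil => simp
  | cons a l ih =>
    rw [List.prod_cons, transpose_mul, List.reverse_cons, List.prod_append, Matrix.mul_assoc,
      hl a (by simp), ← Matrix.mul_assoc, ih fun b hb => hl b (by simp [hb])]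
    simp [Matrix.mul_assoc]

/-- Charge conjugation: a chiral trace does not change if the order of the factors
is reversed. -/
theorem trace_list_prod_reverse (l : List SpinorMatrix)
    (hl : ∀ a ∈ l, aᵀ * chargeConj = chargeConj * a) :
    l.reverse.prod.trace = l.prod.trace := by
  have h := list_prod_transpose_mul_chargeConj l hl
  have h2 : -chargeConj * chargeConj = 1 := by
    rw [← chargeConj_mul_neg]; simp
  calc l.reverse.prod.trace = (-chargeConj * (chargeConj * l.reverse.prod)).trace := by
        rw [← Matrix.mul_assoc, h2, Matrix.one_mul]
    _ = l.prodᵀ.trace := by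
        rw [← h, Matrix.trace_mul_comm, Matrix.mul_assoc, chargeConj_mul_neg, Matrix.mul_one]
    _ = _ := Matrix.trace_transpose _

/-- With only two slashed momenta the γ₅ part of the projector is traceless, hence the result is the
same for both chiralities. -/
theorem trace_proj_slash_slash (s : Bool) (p q : Momentum) :
    (proj s * slash p * slash q).trace = 2 * ((p ⬝ᵥ q : ℝ) : ℂ) := by
  have hI : Complex.I ^ 2 = -1 := Complex.I_sq
  cases s
  · rw [proj_false, slash_eq, slash_eq, fromBlocks_multiply, fromBlocks_multiply, quat_eq, quat_eq,
      adjugate_fin_two_of, adjugate_fin_two_of]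
    simp [trace_fromBlocks', Matrix.trace_fin_two, dotProduct,
      Fin.sum_univ_four]
    linear_combination (-2 * (p 3 : ℂ) * q 3 - 2 * (p 1 : ℂ) * q 1) * hI
  · rw [proj_true, slash_eq, slash_eq, fromBlocks_multiply, fromBlocks_multiply, quat_eq, quat_eq,
      adjugate_fin_two_of, adjugate_fin_two_of]
    simp [trace_fromBlocks', Matrix.trace_fin_two, dotProduct,
      Fin.sum_univ_four]
    linear_combination (-2 * (p 3 : ℂ) * q 3 - 2 * (p 1 : ℂ) * q 1) * hI

/-- The four matrices `weyl μ` form a complex basis of the two by two matrices, so the four unit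
momenta already determine all entries of `B`. -/
theorem eq_zero_of_trace_mul_quat {B : Matrix (Fin 2) (Fin 2) ℂ}
    (h : ∀ p, (B * quat p).trace = 0) : B = 0 := by
  have h0 := h ![1, 0, 0, 0]
  have h1 := h ![0, 1, 0, 0]
  have h2 := h ![0, 0, 1, 0]
  have h3 := h ![0, 0, 0, 1]
  simp [quat_eq, Matrix.trace_fin_two, Matrix.mul_apply] at h0 h1 h2 h3
  have hI : Complex.I ^ 2 = -1 := Complex.I_sq
  ext i j
  fin_cases i <;> fin_cases j <;> simp
  · linear_combination (1 / 2 : ℂ) * h0 - (1 / 2 : ℂ) * Complex.I * h3 +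
      (1 / 2 : ℂ) * (B 0 0 - B 1 1) * hI
  · linear_combination (-1 / 2 : ℂ) * h2 - (1 / 2 : ℂ) * Complex.I * h1 +
      (1 / 2 : ℂ) * (B 0 1 + B 1 0) * hI
  · linear_combination (1 / 2 : ℂ) * h2 - (1 / 2 : ℂ) * Complex.I * h1 +
      (1 / 2 : ℂ) * (B 0 1 + B 1 0) * hI
  · linear_combination (1 / 2 : ℂ) * h0 + (1 / 2 : ℂ) * Complex.I * h3 -
      (1 / 2 : ℂ) * (B 0 0 - B 1 1) * hI

/-- Reflecting the last three components is quaternion conjugation. It reduces the pairing with the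
lower block of `slash` to the pairing with `quat`. -/
theorem exists_quat_eq_adjugate (p : Momentum) : ∃ q, quat p = (quat q).adjugate := by
  refine ⟨![p 0, -p 1, -p 2, -p 3], ?_⟩
  rw [quat_eq, quat_eq, adjugate_fin_two_of]
  ext i j
  fin_cases i <;> fin_cases j <;> simp <;> ring

/-- The trace pairing with slashed momenta is nondegenerate on the chirality flipping matrices. -/
theorem eq_zero_of_trace_mul_slash {D : SpinorMatrix} {s : Bool} (h1 : proj s * D = D)
    (h2 : D * proj (!s) = D) (h : ∀ p, (D * slash p).trace = 0) : D = 0 := by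
  obtain ⟨A, B, C, E, rfl⟩ : ∃ A B C E, D = fromBlocks A B C E :=
    ⟨_, _, _, _, (fromBlocks_toBlocks D).symm⟩
  cases s
  · simp [proj_true, proj_false, fromBlocks_multiply, fromBlocks_inj] at h1 h2
    obtain ⟨rfl, rfl⟩ := h1
    obtain ⟨-, rfl⟩ := h2
    have : C = 0 := eq_zero_of_trace_mul_quat fun p => by
      have := h p
      rw [slash_eq, fromBlocks_multiply] at this
      simpa [trace_fromBlocks'] using this
    rw [this, fromBlocks_zero]
  · simp [proj_true, proj_false, fromBlocks_multiply, fromBlocks_inj] at h1 h2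
    obtain ⟨rfl, rfl⟩ := h1
    obtain ⟨rfl, -⟩ := h2
    have : B = 0 := eq_zero_of_trace_mul_quat fun p => by
      obtain ⟨q, hq⟩ := exists_quat_eq_adjugate p
      have := h q
      rw [slash_eq, fromBlocks_multiply] at this
      simpa [trace_fromBlocks', hq] using this
    rw [this, fromBlocks_zero]

/-- Two successive slashed momenta on a fermion line, seen from the chiral side. -/
theorem slash_mul_slash (p q : Momentum) :
    slash p * slash q =
      fromBlocks (quat p * (quat q).adjugate) 0 0 ((quat p).adjugate * quat q) := by
  simp [slash_eq, fromBlocks_multiply]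

end WessZumino

/-! ### Block matrix tree theorem and cofactors -/

namespace WessZumino
open Matrix

section BlockDeterminant

variable {ι κ R : Type*} [Fintype ι] [DecidableEq ι] [Fintype κ] [DecidableEq κ] [CommRing R]

/-- The inclusion of the block `b`. -/
def blockCol (R : Type*) [CommRing R] (κ : Type*) [DecidableEq κ] (b : ι) : Matrix (ι × κ) κ R :=
  of fun r k => if r = (b, k) then 1 else 0

/-- The sum over all blocks of their inclusions. -/
def blockOnes (ι κ R : Type*) [DecidableEq κ] [CommRing R] : Matrix (ι × κ) κ R :=
  of fun r k => if r.2 = k then 1 else 0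

/-- The matrix with the block `Y` at `(a, b)` and zeros elsewhere. -/
def singleBlock (a b : ι) (Y : Matrix κ κ R) : Matrix (ι × κ) (ι × κ) R :=
  blockCol R κ a * Y * (blockCol R κ b)ᵀ

omit [Fintype ι] in
theorem singleBlock_apply (a b : ι) (Y : Matrix κ κ R) (r c : ι × κ) :
    singleBlock a b Y r c = if r.1 = a ∧ c.1 = b then Y r.2 c.2 else 0 := by
  obtain ⟨r1, r2⟩ := r
  obtain ⟨c1, c2⟩ := c
  by_cases hr : r1 = a <;> by_cases hc : c1 = b <;>
    simp [singleBlock, blockCol, Matrix.mul_apply, Prod.ext_iff, hr, hc]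

omit [Fintype ι] in
theorem singleBlock_transpose (a b : ι) (Y : Matrix κ κ R) :
    (singleBlock a b Y)ᵀ = singleBlock b a Yᵀ := by
  simp [singleBlock, Matrix.mul_assoc]

theorem blockCol_transpose_mul_blockOnes (b : ι) :
    (blockCol R κ b)ᵀ * blockOnes ι κ R = 1 := by
  ext i j
  rw [Matrix.mul_apply, Finset.sum_eq_single (b, i)]
  · simp [blockCol, blockOnes, Matrix.one_apply]
  · intro c _ hc
    simp [blockCol, hc]
  · simp

theorem blockCol_transpose_mul_blockCol (b : ι) :
    (blockCol R κ b)ᵀ * blockCol R κ b = 1 := by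
  ext i j
  simp [blockCol, Matrix.mul_apply, Matrix.one_apply, eq_comm]

omit [DecidableEq ι] in
theorem mul_blockOnes_eq_zero {A : Matrix (ι × κ) (ι × κ) R}
    (hA : ∀ r k, ∑ w, A r (w, k) = 0) : A * blockOnes ι κ R = 0 := by
  ext r k
  simp [blockOnes, Matrix.mul_apply, Fintype.sum_prod_type, hA]

/-- Vanishing block row sums mean that A kills `blockOnes`, so the perturbed matrix factors through
the one with the unit block at `(a, b')`. Sylvester's identity reduces the determinant of the other
factor to that of the small matrix 1 + (Y - 1) = Y. -/
theorem det_add_singleBlock_right {A : Matrix (ι × κ) (ι × κ) R}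
    (hA : ∀ r k, ∑ w, A r (w, k) = 0) (a b b' : ι) (Y : Matrix κ κ R) :
    (A + singleBlock a b Y).det = Y.det * (A + singleBlock a b' 1).det := by
  have hU : A + singleBlock a b Y = (A + singleBlock a b' 1) *
      (1 + blockOnes ι κ R * (Y * (blockCol R κ b)ᵀ - (blockCol R κ b')ᵀ)) := by
    rw [Matrix.mul_add, Matrix.mul_one, ← Matrix.mul_assoc, Matrix.add_mul A,
      mul_blockOnes_eq_zero hA, zero_add, singleBlock, singleBlock, Matrix.mul_one,
      Matrix.mul_assoc _ _ (blockOnes ι κ R), blockCol_transpose_mul_blockOnes, Matrix.mul_one,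
      Matrix.mul_sub, Matrix.mul_assoc]
    abel
  rw [hU, det_mul, det_one_add_mul_comm, Matrix.sub_mul, Matrix.mul_assoc,
    blockCol_transpose_mul_blockOnes, blockCol_transpose_mul_blockOnes, mul_comm]
  simp

theorem det_add_singleBlock_left {A : Matrix (ι × κ) (ι × κ) R}
    (hA : ∀ c k, ∑ v, A (v, k) c = 0) (a a' b : ι) (Y : Matrix κ κ R) :
    (A + singleBlock a b Y).det = Y.det * (A + singleBlock a' b 1).det := by
  have := det_add_singleBlock_right (A := Aᵀ) hA b a a' Yᵀ
  rwa [← singleBlock_transpose, ← transpose_add, det_transpose, det_transpose, ← transpose_one,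
    ← singleBlock_transpose, ← transpose_add, det_transpose] at this

/-- The matrix tree theorem for blocks: if the blocks of all rows and all columns sum to zero,
then all principal cofactors agree. -/
theorem det_add_singleBlock {A : Matrix (ι × κ) (ι × κ) R}
    (hr : ∀ r k, ∑ w, A r (w, k) = 0) (hc : ∀ c k, ∑ v, A (v, k) c = 0) (a b a' b' : ι)
    (Y : Matrix κ κ R) :
    (A + singleBlock a b Y).det = Y.det * (A + singleBlock a' b' 1).det := by
  rw [det_add_singleBlock_right hr a b b', det_add_singleBlock_left hc a a', det_one, one_mul]

/-- The cofactor of the block `(a, b)` does not depend on the other blocks of column `b`. -/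
theorem det_add_singleBlock_one_col {A : Matrix (ι × κ) (ι × κ) R}
    (hA : ∀ r k, ∑ w, A r (w, k) = 0) (a b : ι) :
    (A + singleBlock a b 1).det =
      (of fun r c => (if c.1 = b then 0 else A r c) +
        singleBlock a b (1 : Matrix κ κ R) r c).det := by
  have h1 : (of fun r c => (if c.1 = b then 0 else A r c) +
      singleBlock a b (1 : Matrix κ κ R) r c) =
      A - A * blockCol R κ b * (blockCol R κ b)ᵀ + singleBlock a b 1 := by
    ext r c
    obtain ⟨c1, c2⟩ := c
    by_cases hc : c1 = b
    · subst hc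
      simp [blockCol, Matrix.mul_apply]
    · simp [blockCol, Matrix.mul_apply, hc]
  -- Replacing block column b by the sum of all block columns of A clears it, since that sum is
  -- zero; the corresponding column operation has determinant one by Sylvester's identity.
  have hU : A - A * blockCol R κ b * (blockCol R κ b)ᵀ + singleBlock a b 1 =
      (A + singleBlock a b 1) *
        (1 + (blockOnes ι κ R - blockCol R κ b) * (blockCol R κ b)ᵀ) := by
    rw [Matrix.mul_add, Matrix.mul_one, ← Matrix.mul_assoc, Matrix.mul_sub, Matrix.add_mul A,
      mul_blockOnes_eq_zero hA, Matrix.add_mul, singleBlock, Matrix.mul_one, Matrix.mul_assoc _ _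
      (blockOnes ι κ R), blockCol_transpose_mul_blockOnes, Matrix.mul_assoc _ _ (blockCol R κ b),
      blockCol_transpose_mul_blockCol, Matrix.mul_one, zero_add, Matrix.sub_mul, Matrix.add_mul]
    abel
  rw [h1, hU, det_mul, det_one_add_mul_comm, Matrix.mul_sub, blockCol_transpose_mul_blockOnes,
    blockCol_transpose_mul_blockCol]
  simp

end BlockDeterminant

/-- The degree of a determinant is bounded by the sum of the degrees of the columns. -/
theorem natDegree_det_le {n : Type*} [Fintype n] [DecidableEq n]
    (A : Matrix n n (Polynomial ℂ)) (d : n → ℕ) (h : ∀ i j, (A i j).natDegree ≤ d j) :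
    A.det.natDegree ≤ ∑ j, d j := by
  rw [det_apply']
  refine Polynomial.natDegree_sum_le_of_forall_le _ _ fun σ _ => ?_
  rw [← Polynomial.C_eq_intCast]
  refine (Polynomial.natDegree_C_mul_le _ _).trans ((Polynomial.natDegree_prod_le _ _).trans ?_)
  exact Finset.sum_le_sum fun i _ => h _ _

end WessZumino

/-! ### Signs and traces along the cycles of a permutation -/

namespace WessZumino
open Matrix

/-- The sign is multiplicative, and a fibrewise permutation is a product of permutations moving one
fibre each, which are extensions by the identity and keep their sign. -/
theorem sign_sigmaCongrRight {α : Type*} {β : α → Type*} [Fintype α] [DecidableEq α]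
    [∀ a, Fintype (β a)] [∀ a, DecidableEq (β a)] (F : ∀ a, Equiv.Perm (β a)) :
    Equiv.Perm.sign (Equiv.Perm.sigmaCongrRight F) = ∏ a, Equiv.Perm.sign (F a) := by
  classical
  have key : ∀ a (σ : Equiv.Perm (β a)),
      Equiv.Perm.sign (Equiv.Perm.sigmaCongrRight (Pi.mulSingle a σ)) = Equiv.Perm.sign σ := by
    intro a σ
    let e : β a ≃ {x : Σ a, β a // x.1 = a} :=
      { toFun := fun b => ⟨⟨a, b⟩, rfl⟩
        invFun := fun x => x.2 ▸ x.1.2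
        left_inv := fun b => rfl
        right_inv := by rintro ⟨⟨a, b⟩, rfl⟩; rfl }
    rw [← Equiv.Perm.sign_extendDomain σ e]
    congr 1
    ext1 ⟨a', b⟩
    by_cases h : a' = a
    · subst h
      have := Equiv.Perm.extendDomain_apply_image σ e b
      simpa [e] using this.symm
    · rw [Equiv.Perm.extendDomain_apply_not_subtype _ _ (by simpa using h)]
      simp [Pi.mulSingle_eq_of_ne h]
  have h : ∀ s : Finset α, Equiv.Perm.sign (Equiv.Perm.sigmaCongrRight
      (fun a => if a ∈ s then F a else 1)) = ∏ a ∈ s, Equiv.Perm.sign (F a) := by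
    intro s
    induction s using Finset.induction_on with
    | empty => simp; exact Equiv.Perm.sign_one
    | insert a s ha ih =>
      rw [Finset.prod_insert ha, ← ih, ← key a, ← Equiv.Perm.sign_mul,
        Equiv.Perm.sigmaCongrRight_mul]
      congr 2
      funext b
      by_cases hb : b = a
      · subst hb
        simp [ha]
      · simp [hb]
  simpa using h Finset.univ

/-- Entries of an ordered product of matrices, as a sum over paths. -/
theorem list_prod_apply {κ R : Type*} [Fintype κ] [DecidableEq κ] [CommRing R] (n : ℕ)
    (C : ℕ → Matrix κ κ R) (x y : κ) :
    ((List.range n).map C).prod x y =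
      ∑ i : Fin (n + 1) → κ, if i 0 = x ∧ i (Fin.last n) = y then
        ∏ k : Fin n, C k (i k.castSucc) (i k.succ) else 0 := by
  induction n generalizing y with
  | zero =>
    rw [← (Equiv.funUnique (Fin 1) κ).symm.sum_comp]
    simp [Matrix.one_apply, ite_and]
  | succ n ih =>
    rw [List.range_succ, List.map_append, List.prod_append, Matrix.mul_apply,
      ← (Fin.snocEquiv fun _ => κ).sum_comp, Fintype.sum_prod_type]
    simp only [ih, Finset.sum_mul]
    rw [Finset.sum_comm, Finset.sum_comm (γ := κ)]
    refine Finset.sum_congr rfl fun i _ => ?_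
    have h0 : ∀ z, Fin.snoc (α := fun _ => κ) i z 0 = i 0 := fun z => by
      rw [← Fin.castSucc_zero, Fin.snoc_castSucc]
    by_cases hx : i 0 = x
    · simp [hx, Fin.prod_univ_castSucc, Fin.snocEquiv, h0, ← Fin.castSucc_succ]
    · simp [hx, Fin.snocEquiv, h0]

/-- The trace of a product as a sum over closed paths. -/
theorem trace_list_prod {κ R : Type*} [Fintype κ] [DecidableEq κ] [CommRing R] (n : ℕ)
    (hn : 0 < n) (C : ℕ → Matrix κ κ R) :
    ((List.range n).map C).prod.trace =
      ∑ i : Fin n → κ, ∏ k : Fin n, C k (i k) (i (finRotate n k)) := by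
  obtain ⟨n, rfl⟩ : ∃ m, n = m + 1 := ⟨n - 1, by omega⟩
  simp only [Matrix.trace, Matrix.diag_apply, list_prod_apply]
  rw [Finset.sum_comm, ← (Fin.snocEquiv fun _ => κ).sum_comp, Fintype.sum_prod_type,
    Finset.sum_comm]
  refine Finset.sum_congr rfl fun i _ => ?_
  have h0 : ∀ z, Fin.snoc (α := fun _ => κ) i z 0 = i 0 := fun z => by
    rw [← Fin.castSucc_zero, Fin.snoc_castSucc]
  simp [Fin.snocEquiv, h0, ite_and, Fin.prod_univ_castSucc, ← Fin.castSucc_succ]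

/-- A closed sum over a permutation is the product of the traces over its cycles. -/
theorem sign_mul_sum_prod_perm {S κ A : Type*} [Fintype S] [DecidableEq S] [Fintype κ]
    [DecidableEq κ] [CommRing A] (ρ : Equiv.Perm S) (R : Finset S)
    (hR : ∀ v, ∃! r, r ∈ R ∧ ∃ n : ℕ, ρ^[n] r = v) (C : S → Matrix κ κ A) :
    ((Equiv.Perm.sign ρ : ℤ) : A) * ∑ i : S → κ, ∏ v, C v (i v) (i (ρ v)) =
      ∏ r ∈ R, (-1) ^ (Function.minimalPeriod ρ r - 1) *
        ((List.range (Function.minimalPeriod ρ r)).map fun k => C (ρ^[k] r)).prod.trace := by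
  set l : S → ℕ := fun r => Function.minimalPeriod ρ r with hl
  have hpos : ∀ r, 0 < l r := fun r =>
    Function.minimalPeriod_pos_of_mem_periodicPts (ρ.injective.mem_periodicPts r)
  -- Coordinates on S: a cycle representative and the number of steps from it. In them ρ becomes the
  -- rotation of each cycle, of sign (-1) to the cycle length minus one.
  let F : (Σ r : R, Fin (l r)) → S := fun x => ρ^[x.2] x.1
  have hF : Function.Bijective F := by
    constructor
    · rintro ⟨⟨r, hr⟩, k, hk⟩ ⟨⟨r', hr'⟩, k', hk'⟩ h
      obtain rfl : r = r' := (hR (ρ^[k] r)).unique ⟨hr, k, rfl⟩ ⟨hr', k', h.symm⟩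
      obtain rfl : k = k' := Function.iterate_injOn_Iio_minimalPeriod hk hk' h
      rfl
    · intro v
      obtain ⟨r, ⟨hr, n, hn⟩, -⟩ := hR v
      exact ⟨⟨⟨r, hr⟩, n % l r, Nat.mod_lt _ (hpos r)⟩,
        (Function.iterate_mod_minimalPeriod_eq).trans hn⟩
  let φ := Equiv.ofBijective F hF
  let rot : Equiv.Perm (Σ r : R, Fin (l r)) :=
    Equiv.Perm.sigmaCongrRight fun r => finRotate (l r)
  have hrot : ∀ x, φ (rot x) = ρ (φ x) := by
    rintro ⟨r, k, hk⟩
    change ρ^[(finRotate (l r) ⟨k, hk⟩ : ℕ)] r = ρ (ρ^[k] r)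
    rw [← Function.iterate_succ_apply' ρ k]
    obtain ⟨m, hm⟩ : ∃ m, l r = m + 1 := ⟨l r - 1, by have := hpos r; omega⟩
    have hper : ρ^[l r] r = r := Function.iterate_minimalPeriod
    generalize l r = L at *
    subst hm
    rcases Nat.lt_succ_iff_lt_or_eq.mp hk with h | rfl
    · rw [finRotate_of_lt h]
    · rw [finRotate_last', hper]
      rfl
  have hsign : Equiv.Perm.sign ρ = ∏ r : R, (-1) ^ (l r - 1) := by
    have : ρ = φ.permCongr rot := by
      ext v
      simp [Equiv.permCongr_apply, hrot]
    rw [this, Equiv.Perm.sign_permCongr, sign_sigmaCongrRight]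
    simp [sign_finRotate]
  have hsum : ∑ i : S → κ, ∏ v, C v (i v) (i (ρ v)) =
      ∏ r : R, ((List.range (l r)).map fun k => C (ρ^[k] r)).prod.trace := by
    simp_rw [fun r : R => trace_list_prod (l r) (hpos r) fun k => C (ρ^[k] (r : S))]
    rw [Finset.prod_univ_sum, Fintype.piFinset_univ,
      ← (Equiv.arrowCongr φ (Equiv.refl κ)).sum_comp,
      ← (Equiv.piCurry fun _ _ => κ).symm.sum_comp]
    refine Finset.sum_congr rfl fun i _ => ?_
    rw [← φ.prod_comp, Fintype.prod_sigma]
    refine Finset.prod_congr rfl fun r _ => Finset.prod_congr rfl fun k _ => ?_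
    rw [← hrot]
    simp only [Equiv.arrowCongr_apply, Function.comp, Equiv.symm_apply_apply, Equiv.refl_apply]
    rfl
  rw [hsign, hsum, ← Finset.prod_coe_sort R, Finset.prod_mul_distrib]
  simp [hl]

end WessZumino

namespace WessZumino
open scoped Matrix
namespace CompletedGraph

variable {V E : Type*} [Fintype E] (K : CompletedGraph V E) {f : E → Component}

/-! ### Field assignments -/

theorem mem_incident {v : V} {e : E} : e ∈ K.incident v ↔ K.ends (K.chirality v) e = v := by
  simp [incident]

theorem mem_incident_ends {s : Bool} {e e' : E} :
    e' ∈ K.incident (K.ends s e) ↔ K.ends s e' = K.ends s e := by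
  rw [mem_incident, K.chirality_ends]

theorem card_incident (v : V) : (K.incident v).card = 3 := by
  rw [← K.cubic v, ← Set.ncard_coe_finset]
  congr 1
  ext e
  simp [mem_incident]

/-- At each vertex the nonscalar lines are either one auxiliary line (`x = y`) or two
fermion lines `x`, `y`. -/
theorem isAssignment_iff : K.IsAssignment f ↔ ∀ v, ∃ x ∈ K.incident v, ∃ y ∈ K.incident v,
    ((x = y ∧ f x = .auxiliary) ∨ (x ≠ y ∧ f x = .fermion ∧ f y = .fermion)) ∧
      ∀ z ∈ K.incident v, z ≠ x → z ≠ y → f z = .scalar := by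
  classical
  refine forall_congr' fun v => ?_
  have hc : Multiset.card (K.incident v).val = 3 := K.card_incident v
  have hn : (K.incident v).val.Nodup := (K.incident v).nodup
  simp only [← Finset.mem_val]
  generalize (K.incident v).val = T at hc hn
  constructor
  · rintro (h | h)
    · obtain ⟨x, hx, hfx, h⟩ := (Multiset.map_eq_cons f T _ _).2 h
      refine ⟨x, hx, x, hx, Or.inl ⟨rfl, hfx⟩, fun z hz hzx _ => ?_⟩
      have : f z ∈ (T.erase x).map f :=
        Multiset.mem_map_of_mem f ((Multiset.mem_erase_of_ne hzx).2 hz)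
      simpa [h] using this
    · obtain ⟨x, hx, hfx, h⟩ := (Multiset.map_eq_cons f T _ _).2 h
      obtain ⟨y, hy, hfy, h⟩ := (Multiset.map_eq_cons f _ _ _).2 h
      have hy' := (Multiset.Nodup.mem_erase_iff hn).1 hy
      refine ⟨x, hx, y, hy'.2, Or.inr ⟨hy'.1.symm, hfx, hfy⟩, fun z hz hzx hzy => ?_⟩
      have : f z ∈ ((T.erase x).erase y).map f := Multiset.mem_map_of_mem f
        ((Multiset.mem_erase_of_ne hzy).2 ((Multiset.mem_erase_of_ne hzx).2 hz))
      simpa [h] using this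
  · rintro ⟨x, hx, y, hy, h | h, hz⟩
    · left
      obtain ⟨rfl, hfx⟩ := h
      rw [← Multiset.cons_erase hx, Multiset.map_cons, hfx]
      refine congrArg _ (Multiset.eq_replicate (n := 2) |>.2 ⟨?_, fun b hb => ?_⟩)
      · rw [Multiset.card_map, Multiset.card_erase_of_mem hx, hc]; rfl
      · obtain ⟨z, hz', rfl⟩ := Multiset.mem_map.1 hb
        have := (Multiset.Nodup.mem_erase_iff hn).1 hz'
        exact hz z this.2 this.1 this.1
    · right
      obtain ⟨hxy, hfx, hfy⟩ := h
      have hy' : y ∈ T.erase x := (Multiset.mem_erase_of_ne hxy.symm).2 hy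
      rw [← Multiset.cons_erase hx, ← Multiset.cons_erase hy', Multiset.map_cons,
        Multiset.map_cons, hfx, hfy]
      refine congrArg _ (congrArg _ (Multiset.eq_replicate (n := 1) |>.2 ⟨?_, fun b hb => ?_⟩))
      · rw [Multiset.card_map, Multiset.card_erase_of_mem hy', Multiset.card_erase_of_mem hx, hc]
        rfl
      · obtain ⟨z, hz', rfl⟩ := Multiset.mem_map.1 hb
        have h1 := (Multiset.Nodup.mem_erase_iff (hn.erase x)).1 hz'
        have h2 := (Multiset.Nodup.mem_erase_iff hn).1 h1.2
        exact hz z h2.2 h2.1 h1.1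

variable {K}

theorem IsAssignment.exists_ne_scalar (hf : K.IsAssignment f) {s : Bool} {v : V}
    (hv : K.chirality v = s) : ∃ e, K.ends s e = v ∧ f e ≠ .scalar := by
  obtain ⟨x, hx, y, hy, h, -⟩ := K.isAssignment_iff.1 hf v
  refine ⟨x, hv ▸ K.mem_incident.1 hx, ?_⟩
  rcases h with h | h
  · simp [h.2]
  · simp [h.2.1]

theorem IsAssignment.fermion_of_ne (hf : K.IsAssignment f) {s : Bool} {e e' : E}
    (h : K.ends s e' = K.ends s e) (hne : e' ≠ e) (he : f e ≠ .scalar) (he' : f e' ≠ .scalar) :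
    f e = .fermion := by
  obtain ⟨x, hx, y, hy, hxy, hz⟩ := K.isAssignment_iff.1 hf (K.ends s e)
  have h1 : e = x ∨ e = y := by
    by_contra! h
    exact he (hz e (K.mem_incident_ends.2 rfl) h.1 h.2)
  have h2 : e' = x ∨ e' = y := by
    by_contra! h3
    exact he' (hz e' (K.mem_incident_ends.2 h) h3.1 h3.2)
  grind

theorem IsAssignment.eq_of_ne (hf : K.IsAssignment f) {s : Bool} {e e' e'' : E}
    (h' : K.ends s e' = K.ends s e) (h'' : K.ends s e'' = K.ends s e) (hne' : e' ≠ e)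
    (hne'' : e'' ≠ e) (he : f e ≠ .scalar) (he' : f e' ≠ .scalar) (he'' : f e'' ≠ .scalar) :
    e' = e'' := by
  obtain ⟨x, hx, y, hy, hxy, hz⟩ := K.isAssignment_iff.1 hf (K.ends s e)
  have h1 : e = x ∨ e = y := by
    by_contra! h
    exact he (hz e (K.mem_incident_ends.2 rfl) h.1 h.2)
  have h2 : e' = x ∨ e' = y := by
    by_contra! h
    exact he' (hz e' (K.mem_incident_ends.2 h') h.1 h.2)
  have h3 : e'' = x ∨ e'' = y := by
    by_contra! h
    exact he'' (hz e'' (K.mem_incident_ends.2 h'') h.1 h.2)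
  grind

theorem IsAssignment.exists_partner (hf : K.IsAssignment f) (s : Bool) {e : E}
    (he : f e = .fermion) : ∃ e', e' ≠ e ∧ f e' = .fermion ∧ K.ends s e' = K.ends s e := by
  obtain ⟨x, hx, y, hy, hxy, hz⟩ := K.isAssignment_iff.1 hf (K.ends s e)
  have h1 := hz e (K.mem_incident_ends.2 rfl)
  rw [K.mem_incident_ends] at hx hy
  rw [he] at h1
  rcases hxy with ⟨rfl, h⟩ | ⟨h, h2, h3⟩
  · by_cases hex : e = x
    · simp [← hex, he] at h
    · simpa using h1 hex hex
  · by_cases hex : e = x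
    · exact ⟨y, hex ▸ h.symm, h3, hy⟩
    · exact ⟨x, Ne.symm hex, h2, hx⟩

theorem ends_partner (f : E → Component) (s : Bool) (e : E) :
    K.ends s (K.partner f s e) = K.ends s e := by
  unfold partner
  split_ifs with h
  · exact h.choose_spec.2.2
  · rfl

theorem IsAssignment.partner_ne (hf : K.IsAssignment f) (s : Bool) {e : E}
    (he : f e = .fermion) : K.partner f s e ≠ e := by
  unfold partner
  rw [dif_pos (hf.exists_partner s he)]
  exact (hf.exists_partner s he).choose_spec.1

/-- The default value of `partner` makes `next` turn back at both ends of an auxiliary edge, so the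
edge behaves as a loop of length two. This is why much of what follows is stated for all edges that
are not scalar. -/
theorem IsAssignment.partner_auxiliary (hf : K.IsAssignment f) (s : Bool) {e : E}
    (he : f e = .auxiliary) : K.partner f s e = e := by
  unfold partner
  rw [dif_neg]
  rintro ⟨e', h1, h2, h3⟩
  have := hf.fermion_of_ne h3 h1 (by simp [he]) (by simp [h2])
  simp [he] at this

theorem ne_scalar_iff {c : Component} : c ≠ .scalar ↔ c = .fermion ∨ c = .auxiliary := by
  cases c <;> simp

theorem IsAssignment.apply_partner (hf : K.IsAssignment f) (s : Bool) {e : E}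
    (he : f e ≠ .scalar) : f (K.partner f s e) = f e := by
  rcases ne_scalar_iff.1 he with h | h
  · have := (hf.exists_partner s h).choose_spec.2.1
    rw [h, ← this]
    unfold partner
    rw [dif_pos (hf.exists_partner s h)]
  · rw [hf.partner_auxiliary s h]

theorem IsAssignment.eq_or_eq_partner (hf : K.IsAssignment f) {s : Bool} {e e' : E}
    (he : f e ≠ .scalar) (he' : f e' ≠ .scalar) (h : K.ends s e' = K.ends s e) :
    e' = e ∨ e' = K.partner f s e := by
  by_cases hne : e' = e
  · exact Or.inl hne
  · have hfe := hf.fermion_of_ne h hne he he'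
    exact Or.inr (hf.eq_of_ne h (ends_partner f s e) hne (hf.partner_ne s hfe) he he'
      (by rwa [hf.apply_partner s he]))

theorem IsAssignment.partner_partner (hf : K.IsAssignment f) (s : Bool) {e : E}
    (he : f e ≠ .scalar) : K.partner f s (K.partner f s e) = e := by
  rcases ne_scalar_iff.1 he with h | h
  · have h1 := hf.apply_partner s he
    rcases hf.eq_or_eq_partner (s := s) (h1 ▸ he) he (ends_partner f s e).symm with h2 | h2
    · exact absurd h2.symm (hf.partner_ne s h)
    · exact h2.symm
  · rw [hf.partner_auxiliary s h, hf.partner_auxiliary s h]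

/-! ### Fermion lines as orbits of directed edges -/

/-- The opposite direction. -/
def Dart.rev (d : Dart E) : Dart E := (d.1, !d.2)

omit [Fintype E] in
theorem Dart.rev_rev (d : Dart E) : Dart.rev (Dart.rev d) = d := by simp [Dart.rev]

theorem next_snd (f : E → Component) (d : Dart E) : (K.next f d).2 = !d.2 := rfl

theorem iterate_next_snd (f : E → Component) (d : Dart E) (n : ℕ) :
    ((K.next f)^[n] d).2 = xor d.2 (decide (Odd n)) := by
  induction n with
  | zero => simp
  | succ n ih =>
    rw [Function.iterate_succ_apply', next_snd, ih]
    by_cases h : Odd n <;> simp [h, Nat.odd_add_one]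

theorem IsAssignment.apply_next (hf : K.IsAssignment f) {d : Dart E} (hd : f d.1 ≠ .scalar) :
    f (K.next f d).1 = f d.1 := hf.apply_partner _ hd

theorem IsAssignment.apply_iterate_next (hf : K.IsAssignment f) {d : Dart E}
    (hd : f d.1 ≠ .scalar) (n : ℕ) : f ((K.next f)^[n] d).1 = f d.1 := by
  induction n with
  | zero => rfl
  | succ n ih => rw [Function.iterate_succ_apply', hf.apply_next (by rwa [ih]), ih]

/-- Time reversal: since `partner` is an involution, a step can be undone by reversing, stepping and
reversing again. -/
theorem IsAssignment.next_rev_next (hf : K.IsAssignment f) {d : Dart E} (hd : f d.1 ≠ .scalar) :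
    K.next f (K.next f d).rev = d.rev := by
  simp [next, Dart.rev, hf.partner_partner _ hd]

theorem IsAssignment.iterate_next_rev (hf : K.IsAssignment f) {d : Dart E}
    (hd : f d.1 ≠ .scalar) (n : ℕ) : (K.next f)^[n] ((K.next f)^[n] d).rev = d.rev := by
  induction n with
  | zero => rfl
  | succ n ih =>
    rw [Function.iterate_succ_apply' _ n d, Function.iterate_succ_apply, hf.next_rev_next, ih]
    rwa [hf.apply_iterate_next hd]

theorem IsAssignment.iterate_next_injective (hf : K.IsAssignment f) {d d' : Dart E}
    (hd : f d.1 ≠ .scalar) (hd' : f d'.1 ≠ .scalar) (n : ℕ)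
    (h : (K.next f)^[n] d = (K.next f)^[n] d') : d = d' := by
  have := hf.iterate_next_rev hd n
  rw [h, hf.iterate_next_rev hd'] at this
  rw [← d.rev_rev, ← this, Dart.rev_rev]

/-- There are finitely many directed edges, so the orbit repeats, and steps can be undone on
nonscalar edges. The restriction matters: from a scalar edge, `next` may enter a fermion loop from
outside. -/
theorem IsAssignment.mem_periodicPts (hf : K.IsAssignment f) {d : Dart E}
    (hd : f d.1 ≠ .scalar) : d ∈ Function.periodicPts (K.next f) := by
  obtain ⟨m, n, hmn, h⟩ := Finite.exists_ne_map_eq_of_infinite fun n => (K.next f)^[n] d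
  wlog hlt : m < n generalizing m n
  · exact this n m hmn.symm h.symm (by omega)
  refine ⟨n - m, by omega, ?_⟩
  have h' : (K.next f)^[m] d = (K.next f)^[m] ((K.next f)^[n - m] d) := by
    rw [← Function.iterate_add_apply, Nat.add_sub_cancel' hlt.le]
    exact h
  exact (hf.iterate_next_injective hd (by rwa [hf.apply_iterate_next hd]) m h').symm

theorem IsAssignment.loopLength_pos (hf : K.IsAssignment f) {d : Dart E}
    (hd : f d.1 ≠ .scalar) : 0 < K.loopLength f d :=
  Function.minimalPeriod_pos_of_mem_periodicPts (hf.mem_periodicPts hd)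

theorem even_of_iterate_next_eq {d : Dart E} {n : ℕ} (h : (K.next f)^[n] d = d) : Even n := by
  have := iterate_next_snd (K := K) f d n
  rw [h] at this
  by_contra hn
  rw [Nat.not_even_iff_odd] at hn
  cases hd : d.2 <;> simp [hn, hd] at this

theorem iterate_loopLength (f : E → Component) (d : Dart E) :
    (K.next f)^[K.loopLength f d] d = d := Function.iterate_minimalPeriod

theorem even_loopLength (f : E → Component) (d : Dart E) : Even (K.loopLength f d) :=
  even_of_iterate_next_eq (iterate_loopLength f d)

/-- Reachability along a fermion line. -/
def Reach (K : CompletedGraph V E) (f : E → Component) (d d' : Dart E) : Prop :=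
  ∃ n : ℕ, (K.next f)^[n] d = d'

theorem Reach.refl (d : Dart E) : K.Reach f d d := ⟨0, rfl⟩

theorem Reach.trans {d d' d'' : Dart E} (h : K.Reach f d d') (h' : K.Reach f d' d'') :
    K.Reach f d d'' := by
  obtain ⟨m, rfl⟩ := h
  obtain ⟨n, rfl⟩ := h'
  exact ⟨n + m, Function.iterate_add_apply _ _ _ _⟩

theorem Reach.next (d : Dart E) : K.Reach f d (K.next f d) := ⟨1, rfl⟩

theorem Reach.apply (hf : K.IsAssignment f) {d d' : Dart E} (hd : f d.1 ≠ .scalar)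
    (h : K.Reach f d d') : f d'.1 = f d.1 := by
  obtain ⟨n, rfl⟩ := h
  exact hf.apply_iterate_next hd n

theorem Reach.symm (hf : K.IsAssignment f) {d d' : Dart E} (hd : f d.1 ≠ .scalar)
    (h : K.Reach f d d') : K.Reach f d' d := by
  obtain ⟨n, rfl⟩ := h
  refine ⟨K.loopLength f d * n - n, ?_⟩
  rw [← Function.iterate_add_apply, Nat.sub_add_cancel
    (Nat.le_mul_of_pos_left n (hf.loopLength_pos hd))]
  exact (Function.isPeriodicPt_minimalPeriod (K.next f) d).mul_const n

theorem Reach.rev (hf : K.IsAssignment f) {d d' : Dart E} (hd : f d.1 ≠ .scalar)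
    (h : K.Reach f d d') : K.Reach f d.rev d'.rev := by
  obtain ⟨n, rfl⟩ := h
  have : K.Reach f ((K.next f)^[n] d).rev d.rev := ⟨n, hf.iterate_next_rev hd n⟩
  exact this.symm hf (by change f ((K.next f)^[n] d).1 ≠ _; rwa [hf.apply_iterate_next hd])

/-- A fermion line does not return to one of its edges in the opposite direction. -/
theorem IsAssignment.not_reach_rev (hf : K.IsAssignment f) {d : Dart E}
    (hd : f d.1 = .fermion) : ¬ K.Reach f d d.rev := by
  have hd' : f d.1 ≠ .scalar := by simp [hd]
  rintro ⟨n, hn⟩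
  rcases Nat.even_or_odd' n with ⟨k, rfl | rfl⟩
  · have := iterate_next_snd (K := K) f d (2 * k)
    rw [hn] at this
    cases hs : d.2 <;> simp [Dart.rev, hs, ← Nat.not_even_iff_odd] at this
  -- After an odd number of steps, walking k steps from both ends meets in the middle at a single
  -- step that turns back on its own edge, which no fermionic edge allows.
  · have h1 := hf.iterate_next_rev hd' k
    rw [← hn, two_mul, add_assoc, Function.iterate_add_apply] at h1
    have h2 := hf.iterate_next_injective (n := k)
      (by change f ((K.next f)^[k] d).1 ≠ _; rwa [hf.apply_iterate_next hd'])
      (by rwa [hf.apply_iterate_next hd']) h1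
    rw [Function.iterate_succ_apply'] at h2
    have h3 := congrArg Prod.fst h2
    exact hf.partner_ne _ (by rwa [hf.apply_iterate_next hd']) h3.symm

theorem mem_loopOf {e e' : E} :
    e' ∈ K.loopOf f e ↔ ∃ s, K.Reach f (e, true) (e', s) := by
  simp only [loopOf, Finset.mem_filter, Finset.mem_univ, true_and, Reach]
  constructor
  · rintro ⟨n, rfl⟩
    exact ⟨_, n, rfl⟩
  · rintro ⟨s, n, h⟩
    exact ⟨n, by rw [h]⟩

theorem self_mem_loopOf (f : E → Component) (e : E) : e ∈ K.loopOf f e :=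
  mem_loopOf.2 ⟨true, Reach.refl _⟩

theorem IsAssignment.loopOf_subset (hf : K.IsAssignment f) {e e' : E} (he : f e ≠ .scalar)
    {s : Bool} (h : K.Reach f (e, true) (e', s)) : K.loopOf f e' ⊆ K.loopOf f e := by
  intro e'' h''
  obtain ⟨s', h'⟩ := mem_loopOf.1 h''
  have he' : f e' ≠ .scalar := by rw [← h.apply hf he] at he; exact he
  cases s
  · have h2 : K.Reach f (e', false) (e'', !s') := h'.rev hf he'
    exact mem_loopOf.2 ⟨_, h.trans h2⟩
  · exact mem_loopOf.2 ⟨_, h.trans h'⟩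

theorem IsAssignment.loopOf_eq (hf : K.IsAssignment f) {e e' : E} (he : f e ≠ .scalar)
    {s s' : Bool} (h : K.Reach f (e, s) (e', s')) : K.loopOf f e' = K.loopOf f e := by
  wlog hs : s = true generalizing s s'
  · obtain rfl : s = false := by simpa using hs
    exact this (h.rev hf he) rfl
  subst hs
  have he' : f e' ≠ .scalar := by rw [← h.apply hf he] at he; exact he
  refine (hf.loopOf_subset he h).antisymm ?_
  have h' := h.symm hf he
  cases s'
  · exact hf.loopOf_subset he' (h'.rev hf he')
  · exact hf.loopOf_subset he' h'

theorem IsAssignment.loopOf_eq_of_mem (hf : K.IsAssignment f) {e e' : E} (he : f e ≠ .scalar)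
    (h : e' ∈ K.loopOf f e) : K.loopOf f e' = K.loopOf f e := by
  obtain ⟨s, h⟩ := mem_loopOf.1 h
  exact hf.loopOf_eq he h

theorem IsAssignment.apply_of_mem_loopOf (hf : K.IsAssignment f) {e e' : E} (he : f e ≠ .scalar)
    (h : e' ∈ K.loopOf f e) : f e' = f e := by
  obtain ⟨s, h⟩ := mem_loopOf.1 h
  exact h.apply hf he

end CompletedGraph

namespace CompletedGraph

variable {V E : Type*} [Fintype E] {K : CompletedGraph V E} {f : E → Component}
  {p p' : E → Momentum}

/-! ### Invariance of the chiral trace of a fermion loop -/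

/-- The slashed momentum on the `i`-th directed edge of the line that starts with `d`. -/
noncomputable def lineSlash (K : CompletedGraph V E) (f : E → Component) (p : E → Momentum)
    (d : Dart E) (i : ℕ) : SpinorMatrix :=
  slash (dartMomentum p ((K.next f)^[i] d))

theorem lineProduct_eq (d : Dart E) (n : ℕ) :
    K.lineProduct f p d n = ((List.range n).map (K.lineSlash f p d)).prod := rfl

theorem lineProduct_succ (d : Dart E) (n : ℕ) :
    K.lineProduct f p d (n + 1) = K.lineProduct f p d n * K.lineSlash f p d n := by
  simp [lineProduct_eq, List.range_succ]

theorem lineProduct_succ' (d : Dart E) (n : ℕ) :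
    K.lineProduct f p d (n + 1) =
      slash (dartMomentum p d) * K.lineProduct f p (K.next f d) n := by
  simp only [lineProduct_eq, List.range_succ_eq_map, List.map_cons, List.prod_cons, List.map_map]
  rfl

theorem IsAssignment.loopLength_next (hf : K.IsAssignment f) {d : Dart E}
    (hd : f d.1 ≠ .scalar) : K.loopLength f (K.next f d) = K.loopLength f d :=
  Function.minimalPeriod_apply (hf.mem_periodicPts hd)

/-- The loop trace in terms of the line from which the first edge is removed. -/
theorem IsAssignment.loopTrace_eq_open (hf : K.IsAssignment f) {d : Dart E}
    (hd : f d.1 ≠ .scalar) : K.loopTrace f p d =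
      (proj (!d.2) * K.lineProduct f p (K.next f d) (K.loopLength f d - 1) *
        slash (dartMomentum p d)).trace := by
  obtain ⟨m, hm⟩ : ∃ m, K.loopLength f d = m + 1 :=
    ⟨_, (Nat.sub_add_cancel (hf.loopLength_pos hd)).symm⟩
  rw [loopTrace, hm, lineProduct_succ', ← Matrix.mul_assoc, proj_mul_slash, Matrix.mul_assoc,
    Matrix.trace_mul_comm]
  rfl

theorem IsAssignment.loopTrace_next (hf : K.IsAssignment f) {d : Dart E}
    (hd : f d.1 ≠ .scalar) : K.loopTrace f p (K.next f d) = K.loopTrace f p d := by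
  rw [hf.loopTrace_eq_open hd, loopTrace, hf.loopLength_next hd, next_snd]
  obtain ⟨m, hm⟩ : ∃ m, K.loopLength f d = m + 1 :=
    ⟨_, (Nat.sub_add_cancel (hf.loopLength_pos hd)).symm⟩
  have h : K.lineSlash f p (K.next f d) m = slash (dartMomentum p d) := by
    rw [lineSlash, ← Function.iterate_succ_apply, Nat.succ_eq_add_one, ← hm, iterate_loopLength]
  rw [hm, lineProduct_succ, h, Nat.add_sub_cancel, Matrix.mul_assoc]

theorem Reach.loopTrace_eq (hf : K.IsAssignment f) {d d' : Dart E}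
    (hd : f d.1 ≠ .scalar) (h : K.Reach f d d') : K.loopTrace f p d' = K.loopTrace f p d := by
  obtain ⟨n, rfl⟩ := h
  induction n with
  | zero => rfl
  | succ n ih =>
    rw [Function.iterate_succ_apply', hf.loopTrace_next (by rwa [hf.apply_iterate_next hd]), ih]

omit [Fintype E] in
theorem dartMomentum_rev (p : E → Momentum) (d : Dart E) :
    dartMomentum p d.rev = -dartMomentum p d := by
  obtain ⟨e, s⟩ := d
  cases s <;> simp [dartMomentum, Dart.rev]

theorem IsAssignment.loopLength_rev (hf : K.IsAssignment f) {d : Dart E}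
    (hd : f d.1 ≠ .scalar) : K.loopLength f d.rev = K.loopLength f d := by
  have key : ∀ {d : Dart E}, f d.1 ≠ .scalar → K.loopLength f d.rev ∣ K.loopLength f d := by
    intro d hd
    refine Function.IsPeriodicPt.minimalPeriod_dvd ?_
    have := hf.iterate_next_rev hd (K.loopLength f d)
    rwa [iterate_loopLength] at this
  refine Nat.dvd_antisymm (key hd) ?_
  have := key (d := d.rev) hd
  rwa [Dart.rev_rev] at this

theorem IsAssignment.lineSlash_rev (hf : K.IsAssignment f) {d : Dart E}
    (hd : f d.1 ≠ .scalar) {i j : ℕ} (h : i + j = K.loopLength f d) :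
    K.lineSlash f p d.rev i = -K.lineSlash f p d j := by
  have h1 : (K.next f)^[i] d.rev = ((K.next f)^[j] d).rev := by
    have h2 := hf.iterate_next_rev (d := (K.next f)^[j] d) (by rwa [hf.apply_iterate_next hd]) i
    rwa [← Function.iterate_add_apply, h, iterate_loopLength] at h2
  rw [lineSlash, h1, dartMomentum_rev, slash_neg, lineSlash]

/-- The chiral trace is the same for both directions of a fermion loop. -/
theorem IsAssignment.loopTrace_rev (hf : K.IsAssignment f) {d : Dart E}
    (hd : f d.1 ≠ .scalar) : K.loopTrace f p d.rev = K.loopTrace f p d := by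
  have hL := hf.loopLength_next hd
  -- Position i on the reversed loop is minus position n - i on the original one. Starting the
  -- latter one step later turns this into the exact list reversal i ↦ n - 1 - i. The signs cancel
  -- because n is even, and charge conjugation undoes the reversal.
  rw [← hf.loopTrace_next hd, loopTrace, loopTrace, hf.loopLength_rev hd, hL]
  set n := K.loopLength f d with hn
  have h1 : K.lineProduct f p d.rev n =
      ((List.range n).map (K.lineSlash f p (K.next f d))).reverse.prod := by
    have h2 : (List.range n).map (K.lineSlash f p d.rev) =
        (((List.range n).map (K.lineSlash f p (K.next f d))).reverse).map Neg.neg := by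
      refine List.ext_getElem (by simp) fun i h1 h2 => ?_
      have hi : i < n := by simpa using h1
      simp only [List.getElem_map, List.getElem_range, List.getElem_reverse, List.length_map,
        List.length_range]
      rw [hf.lineSlash_rev hd (j := n - i) (by omega), lineSlash, lineSlash,
        ← Function.iterate_succ_apply]
      congr 6
      omega
    have h3 := even_loopLength (K := K) f d
    rw [lineProduct_eq, h2, List.prod_map_neg, List.length_reverse, List.length_map,
      List.length_range, h3.neg_one_pow, one_mul]
  rw [h1, Matrix.trace_mul_comm, lineProduct_eq, ← List.prod_cons, ← trace_list_prod_reverse,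
    List.reverse_cons, List.prod_append, List.prod_singleton]
  · rfl
  · intro a ha
    rcases List.mem_cons.1 ha with rfl | ha
    · exact proj_transpose _
    · obtain ⟨i, -, rfl⟩ := List.mem_map.1 ha
      exact slash_transpose _

theorem IsAssignment.loopTrace_eq_of_mem_loopOf (hf : K.IsAssignment f) {e e' : E}
    (he : f e ≠ .scalar) (h : e' ∈ K.loopOf f e) (s s' : Bool) :
    K.loopTrace f p (e', s') = K.loopTrace f p (e, s) := by
  have h1 : ∀ e, f e ≠ .scalar → ∀ s, K.loopTrace f p (e, s) = K.loopTrace f p (e, true) := by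
    intro e he s
    cases s
    · exact (hf.loopTrace_rev (d := (e, false)) he).symm
    · rfl
  obtain ⟨s'', h⟩ := mem_loopOf.1 h
  have he' : f e' ≠ .scalar := by
    rw [← h.apply hf he] at he
    exact he
  rw [h1 e he, h1 e' he', ← h.loopTrace_eq hf he, h1 e' he' s'']

/-- The loop factor may be computed from any edge and with any direction. -/
theorem IsAssignment.loopFactor_loopOf (hf : K.IsAssignment f) {e : E} (he : f e ≠ .scalar)
    (s : Bool) : K.loopFactor f p (K.loopOf f e) = -K.loopTrace f p (e, s) := by
  have h : (K.loopOf f e).Nonempty := ⟨e, self_mem_loopOf f e⟩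
  rw [loopFactor, dif_pos h, hf.loopTrace_eq_of_mem_loopOf he h.choose_spec s]

theorem lineProduct_congr {d : Dart E} {n : ℕ}
    (h : ∀ i < n, p ((K.next f)^[i] d).1 = p' ((K.next f)^[i] d).1) :
    K.lineProduct f p d n = K.lineProduct f p' d n := by
  unfold lineProduct
  congr 1
  refine List.map_congr_left fun i hi => ?_
  simp only [dartMomentum, h i (List.mem_range.1 hi)]

theorem loopFactor_loopOf_congr (hf : K.IsAssignment f) {e : E} (he : f e ≠ .scalar)
    (h : ∀ e' ∈ K.loopOf f e, p e' = p' e') :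
    K.loopFactor f p (K.loopOf f e) = K.loopFactor f p' (K.loopOf f e) := by
  rw [hf.loopFactor_loopOf he true, hf.loopFactor_loopOf he true, loopTrace, loopTrace,
    lineProduct_congr]
  exact fun i _ => h _ (mem_loopOf.2 ⟨_, i, rfl⟩)

theorem mem_loops {C : Finset E} :
    C ∈ K.loops f ↔ ∃ e, f e = .fermion ∧ K.loopOf f e = C := by
  simp [loops]

/-- The loop through the added link is left out of the weight, and so is its p². Thus the momentum
on this link can be varied freely, violating conservation, without changing the weight. -/
theorem weight_congr (hf : K.IsAssignment f) {e : E} (h : ∀ e', e' ≠ e → p e' = p' e') :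
    K.weight e f p = K.weight e f p' := by
  classical
  unfold weight
  congr 1
  · refine Finset.prod_congr rfl fun e' he' => ?_
    rw [h e' (Finset.mem_filter.1 he').2.1]
  · refine Finset.prod_congr rfl fun C hC => ?_
    obtain ⟨hC, heC⟩ := Finset.mem_filter.1 hC
    obtain ⟨e', he', rfl⟩ := mem_loops.1 hC
    refine loopFactor_loopOf_congr hf (by simp [he']) fun e'' he'' => h _ ?_
    rintro rfl
    exact heC he''

/-- The open line does not meet `e` again: in the same direction this would contradict minimality of
the period, in the opposite one `not_reach_rev`. -/
theorem openLine_congr (hf : K.IsAssignment f) {e : E} (he : f e = .fermion) (s : Bool)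
    (h : ∀ e', e' ≠ e → p e' = p' e') : K.openLine e s f p = K.openLine e s f p' := by
  have he' : f e ≠ .scalar := by simp [he]
  unfold openLine
  rw [lineProduct_congr]
  intro i hi
  refine h _ fun hei => ?_
  rw [← Function.iterate_succ_apply] at hei
  by_cases hs : ((K.next f)^[i + 1] (e, !s)).2 = !s
  · exact Function.not_isPeriodicPt_of_pos_of_lt_minimalPeriod (Nat.succ_ne_zero i)
      (Nat.add_lt_of_lt_sub hi) (Prod.ext hei hs)
  · refine hf.not_reach_rev (d := (e, !s)) he ⟨i + 1, Prod.ext hei ?_⟩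
    change _ = !!s
    generalize ((K.next f)^[i + 1] (e, !s)).2 = b at hs
    revert hs
    cases b <;> cases s <;> simp

/-! ### The weight of a field assignment of the completed graph -/

open Classical in
/-- The numerator of a field assignment, with no edge removed. -/
noncomputable def fullWeight (K : CompletedGraph V E) (f : E → Component) (p : E → Momentum) : ℂ :=
  (∏ e with f e = .auxiliary, ((p e ⬝ᵥ p e : ℝ) : ℂ)) * ∏ C ∈ K.loops f, K.loopFactor f p C

theorem IsAssignment.notMem_of_mem_loops (hf : K.IsAssignment f) {e : E} (he : f e ≠ .fermion)
    {C : Finset E} (hC : C ∈ K.loops f) : e ∉ C := by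
  obtain ⟨e', he', rfl⟩ := mem_loops.1 hC
  intro h
  rw [hf.apply_of_mem_loopOf (by simp [he']) h] at he
  exact he he'

theorem fullWeight_of_scalar (hf : K.IsAssignment f) {e : E} (he : f e = .scalar) :
    K.fullWeight f p = K.weight e f p := by
  classical
  unfold fullWeight weight
  congr 1
  · refine Finset.prod_congr (Finset.filter_congr fun e' _ => ?_) fun _ _ => rfl
    refine ⟨fun h => ⟨?_, h⟩, fun h => h.2⟩
    rintro rfl
    simp [he] at h
  · rw [Finset.filter_true_of_mem]
    exact fun C hC => hf.notMem_of_mem_loops (by simp [he]) hC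

theorem fullWeight_of_auxiliary (hf : K.IsAssignment f) {e : E} (he : f e = .auxiliary) :
    K.fullWeight f p = ((p e ⬝ᵥ p e : ℝ) : ℂ) * K.weight e f p := by
  classical
  unfold fullWeight weight
  rw [← mul_assoc]
  congr 1
  · rw [← Finset.mul_prod_erase _ _ (Finset.mem_filter.2 ⟨Finset.mem_univ e, he⟩)]
    congr 1
    refine Finset.prod_congr ?_ fun _ _ => rfl
    ext e'
    simp
  · rw [Finset.filter_true_of_mem]
    exact fun C hC => hf.notMem_of_mem_loops (by simp [he]) hC

/-- The loop through `e` is cut open at `e`; it is the only factor that contains the momentum on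
`e`, and it does so linearly. -/
theorem fullWeight_of_fermion (hf : K.IsAssignment f) {e : E} (he : f e = .fermion) (s : Bool) :
    K.fullWeight f p =
      K.weight e f p * -(K.openLine e s f p * slash (dartMomentum p (e, !s))).trace := by
  classical
  have he' : f e ≠ .scalar := by simp [he]
  have h1 : (K.openLine e s f p * slash (dartMomentum p (e, !s))).trace =
      K.loopTrace f p (e, !s) := by
    rw [hf.loopTrace_eq_open he', openLine, Bool.not_not]
  unfold fullWeight weight
  rw [h1, ← hf.loopFactor_loopOf he', mul_assoc]
  congr 1
  · refine Finset.prod_congr (Finset.filter_congr fun e' _ => ?_) fun _ _ => rfl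
    refine ⟨fun h => ⟨?_, h⟩, fun h => h.2⟩
    rintro rfl
    simp [he] at h
  · rw [← Finset.prod_erase_mul _ _ (mem_loops.2 ⟨e, he, rfl⟩)]
    congr 1
    refine Finset.prod_congr ?_ fun _ _ => rfl
    ext C
    rw [Finset.mem_erase, Finset.mem_filter]
    refine ⟨fun h => ⟨h.2, fun hC => h.1 ?_⟩, fun h => ⟨?_, h.1⟩⟩
    · obtain ⟨e', h', rfl⟩ := mem_loops.1 h.2
      exact (hf.loopOf_eq_of_mem (by simp [h']) hC).symm
    · rintro rfl
      exact h.2 (self_mem_loopOf f e)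

theorem proj_mul_lineProduct (s : Bool) (d : Dart E) (n : ℕ) :
    proj s * K.lineProduct f p d n = K.lineProduct f p d n * proj (xor s (decide (Odd n))) := by
  induction n with
  | zero => simp [lineProduct_eq]
  | succ n ih =>
    rw [lineProduct_succ, ← Matrix.mul_assoc, ih, Matrix.mul_assoc, lineSlash, proj_mul_slash,
      Matrix.mul_assoc]
    by_cases h : Odd n <;> simp [h, Nat.odd_add_one]

theorem proj_mul_openLine (e : E) (s : Bool) :
    proj s * K.openLine e s f p = K.openLine e s f p := by
  rw [openLine, ← Matrix.mul_assoc, proj_mul_self]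

/-- A loop is even, so the open line has an odd number of slashed momenta and flips the chirality.
-/
theorem IsAssignment.openLine_mul_proj (hf : K.IsAssignment f) {e : E} (he : f e = .fermion)
    (s : Bool) : K.openLine e s f p * proj (!s) = K.openLine e s f p := by
  have hL : Odd (K.loopLength f (e, !s) - 1) :=
    Nat.Even.sub_odd (hf.loopLength_pos (d := (e, !s)) (by simp [he])) (even_loopLength _ _)
      odd_one
  rw [openLine, proj_mul_lineProduct, Matrix.mul_assoc]
  simp [hL, proj_mul_self]

end CompletedGraph

namespace CompletedGraph

variable {V E : Type*} [Fintype E] {K : CompletedGraph V E} {f : E → Component}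
  {p : E → Momentum}

/-! ### Orientation of the fermion loops -/

/-- The vertices of chirality `s`. -/
abbrev Side (K : CompletedGraph V E) (s : Bool) : Type _ := {v : V // K.chirality v = s}

/-- The end of chirality `s` of an edge. -/
def endOf (K : CompletedGraph V E) (s : Bool) (e : E) : K.Side s :=
  ⟨K.ends s e, K.chirality_ends s e⟩

omit [Fintype E] in
theorem endOf_eq_iff {s : Bool} {e e' : E} :
    K.endOf s e = K.endOf s e' ↔ K.ends s e = K.ends s e' := Subtype.ext_iff

/-- A chosen edge on the loop of `e`. -/
noncomputable def loopRep (K : CompletedGraph V E) (f : E → Component) (e : E) : E :=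
  Exists.choose (⟨e, self_mem_loopOf f e⟩ : (K.loopOf f e).Nonempty)

theorem loopRep_mem (f : E → Component) (e : E) : K.loopRep f e ∈ K.loopOf f e :=
  Exists.choose_spec (⟨e, self_mem_loopOf f e⟩ : (K.loopOf f e).Nonempty)

theorem loopRep_congr {e e' : E} (h : K.loopOf f e = K.loopOf f e') :
    K.loopRep f e = K.loopRep f e' := by
  have key : ∀ (C C' : Finset E) (hC : C.Nonempty) (hC' : C'.Nonempty), C = C' →
      Exists.choose hC = Exists.choose hC' := by
    rintro C _ hC hC' rfl
    rfl
  exact key _ _ _ _ h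

theorem IsAssignment.loopRep_auxiliary (hf : K.IsAssignment f) {e : E} (he : f e = .auxiliary) :
    K.loopRep f e = e := by
  have h : ∀ n, ((K.next f)^[n] (e, true)).1 = e := by
    intro n
    induction n with
    | zero => rfl
    | succ n ih =>
      rw [Function.iterate_succ_apply']
      simp only [CompletedGraph.next]
      rw [ih, hf.partner_auxiliary _ he]
  obtain ⟨s, n, hn⟩ := mem_loopOf.1 (loopRep_mem (K := K) f e)
  have := h n
  rwa [hn] at this

/-- The edges that are traversed from the chiral to the antichiral end, if each loop is
given the direction of its chosen edge. -/
def Forward (K : CompletedGraph V E) (f : E → Component) (e : E) : Prop :=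
  f e ≠ .scalar ∧ K.Reach f (K.loopRep f e, true) (e, true)

/-- For `s = true` the partner is the next directed edge; for `s = false` it is the previous one,
reached by going around the loop. -/
theorem IsAssignment.reach_partner (hf : K.IsAssignment f) {e : E} (he : f e ≠ .scalar)
    (s : Bool) : K.Reach f (e, false) (K.partner f s e, true) := by
  cases s
  · have he' : f (K.partner f false e) ≠ .scalar := by rwa [hf.apply_partner _ he]
    have : K.Reach f (K.partner f false e, true) (e, false) :=
      ⟨1, by simp [CompletedGraph.next, hf.partner_partner _ he]⟩
    exact this.symm hf he'
  · exact Reach.next _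

/-- The two fermion edges at a vertex are successive on their loop, and the direction relative to
chirality alternates, so one of them is forward. If both were, the line would return to an edge in
the opposite direction. An auxiliary edge is its own loop and is forward. -/
theorem IsAssignment.existsUnique_forward (hf : K.IsAssignment f) {s : Bool} (v : K.Side s) :
    ∃! e, K.Forward f e ∧ K.endOf s e = v := by
  obtain ⟨x, hxv, hx⟩ := hf.exists_ne_scalar v.2
  obtain ⟨e, he⟩ : ∃ e, K.Forward f e ∧ K.endOf s e = v := by
    have h1 : x ∈ K.loopOf f (K.loopRep f x) := by
      rw [hf.loopOf_eq_of_mem hx (loopRep_mem f x)]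
      exact self_mem_loopOf f x
    obtain ⟨s', h⟩ := mem_loopOf.1 h1
    cases s'
    · have h2 := hf.reach_partner hx s
      refine ⟨K.partner f s x, ⟨by rwa [hf.apply_partner _ hx], ?_⟩, ?_⟩
      · rw [loopRep_congr (hf.loopOf_eq hx h2)]
        exact h.trans h2
      · exact Subtype.ext ((ends_partner f s x).trans hxv)
    · exact ⟨x, ⟨hx, h⟩, Subtype.ext hxv⟩
  refine ⟨e, he, fun e' he' => ?_⟩
  obtain ⟨⟨h1, h2⟩, h3⟩ := he
  obtain ⟨⟨h1', h2'⟩, h3'⟩ := he'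
  rcases hf.eq_or_eq_partner h1 h1' (endOf_eq_iff.1 (h3'.trans h3.symm)) with h | h
  · exact h
  · rcases ne_scalar_iff.1 h1 with hfe | hfe
    · exfalso
      have h4 := hf.reach_partner h1 s
      rw [← h] at h4
      rw [loopRep_congr (hf.loopOf_eq h1 h4)] at h2'
      have hrep : f (K.loopRep f e) ≠ .scalar := by
        rwa [hf.apply_of_mem_loopOf h1 (loopRep_mem f e)]
      exact hf.not_reach_rev (d := (e, true)) hfe
        (((h2.symm hf hrep).trans h2').trans (h4.symm hf h1))
    · rw [h, hf.partner_auxiliary s hfe]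

theorem lineProduct_two_mul (d : Dart E) (n : ℕ) :
    K.lineProduct f p d (2 * n) = ((List.range n).map fun k =>
      K.lineSlash f p d (2 * k) * K.lineSlash f p d (2 * k + 1)).prod := by
  induction n with
  | zero => simp [lineProduct_eq]
  | succ n ih =>
    rw [Nat.mul_succ, lineProduct_succ, lineProduct_succ, ih, List.range_succ]
    simp [Matrix.mul_assoc]

theorem list_prod_fromBlocks (n : ℕ) (A B : ℕ → Matrix (Fin 2) (Fin 2) ℂ) :
    ((List.range n).map fun k => Matrix.fromBlocks (A k) 0 0 (B k)).prod =
      Matrix.fromBlocks ((List.range n).map A).prod 0 0 ((List.range n).map B).prod := by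
  induction n with
  | zero => simp
  | succ n ih => simp [List.range_succ, ih, Matrix.fromBlocks_multiply]

/-- The chiral trace in two component notation. -/
theorem loopTrace_eq_of_loopLength {e : E} {n : ℕ} (hn : K.loopLength f (e, true) = 2 * n)
    {x : ℕ → E} (hx : ∀ k, (K.next f)^[2 * k] (e, true) = (x k, true)) :
    K.loopTrace f p (e, true) = (-1) ^ n * ((List.range n).map fun k =>
      quat (p (x k)) * (quat (p (K.partner f false (x k)))).adjugate).prod.trace := by
  -- Two steps at a time: out along a forward edge with `quat`, back along its partner with the
  -- adjugate. The minus sign comes from traversing the second edge against its momentum.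
  have h1 : ∀ k, K.lineSlash f p (e, true) (2 * k) * K.lineSlash f p (e, true) (2 * k + 1) =
      Matrix.fromBlocks (-(quat (p (x k)) * (quat (p (K.partner f false (x k)))).adjugate)) 0 0
        (-((quat (p (x k))).adjugate * quat (p (K.partner f false (x k))))) := by
    intro k
    rw [lineSlash, lineSlash, Function.iterate_succ_apply', hx]
    simp only [next, dartMomentum, Bool.not_true, if_true, Bool.false_eq_true, if_false]
    rw [slash_neg, mul_neg, slash_mul_slash, Matrix.fromBlocks_neg, neg_zero]
  have h2 : ((List.range n).map fun k =>
      -(quat (p (x k)) * (quat (p (K.partner f false (x k)))).adjugate)) =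
      (((List.range n).map fun k =>
        quat (p (x k)) * (quat (p (K.partner f false (x k)))).adjugate)).map Neg.neg := by
    rw [List.map_map]
    rfl
  rw [loopTrace, hn, lineProduct_two_mul]
  simp only [h1]
  rw [list_prod_fromBlocks, proj_true, Matrix.fromBlocks_multiply, trace_fromBlocks', h2,
    List.prod_map_neg]
  rcases Nat.even_or_odd n with h | h <;> simp [h.neg_one_pow]

/-- Read as a fermion loop, an auxiliary edge carries p and then -p, and gives twice the desired p².
This is the origin of the powers of two below. -/
theorem loopTrace_auxiliary (hf : K.IsAssignment f) {e : E} (he : f e = .auxiliary) :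
    -K.loopTrace f p (e, true) = 2 * ((p e ⬝ᵥ p e : ℝ) : ℂ) := by
  have h1 : K.next f (e, true) = (e, false) := by
    simp [next, hf.partner_auxiliary _ he]
  have h2 : K.next f (e, false) = (e, true) := by
    simp [next, hf.partner_auxiliary _ he]
  have h3 : K.loopLength f (e, true) = 2 := by
    have h4 := hf.loopLength_pos (d := (e, true)) (by simp [he])
    obtain ⟨k, hk⟩ := even_loopLength (K := K) f (e, true)
    have h5 : K.loopLength f (e, true) ∣ 2 := Function.IsPeriodicPt.minimalPeriod_dvd (by
      change (K.next f)^[2] _ = _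
      rw [Function.iterate_succ_apply, Function.iterate_one, h1, h2])
    have := Nat.le_of_dvd (by norm_num) h5
    omega
  rw [loopTrace, h3, lineProduct_succ', h1, lineProduct_succ', h2]
  simp only [dartMomentum, if_true, Bool.false_eq_true, if_false, lineProduct_eq, List.range_zero,
    List.map_nil, List.prod_nil, mul_one, slash_neg, mul_neg, Matrix.trace_neg, neg_neg]
  rw [← Matrix.mul_assoc, trace_proj_slash_slash]

open Classical in
/-- An orientation of the fermion loops of a field assignment: a perfect matching `m` of forward
edges, the permutation `ρ` which follows the fermion lines, and the numerator
as a closed sum over this permutation. -/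
theorem IsAssignment.exists_orientation [Fintype V] (hf : K.IsAssignment f) :
    ∃ (m : K.Side true → E) (σ : K.Side true ≃ K.Side false) (ρ : Equiv.Perm (K.Side true)),
      (∀ v, K.endOf true (m v) = v) ∧ (∀ v, K.endOf false (m v) = σ v) ∧
      (∀ v, f (m v) ≠ .scalar) ∧
      (∀ v, K.partner f true (m (ρ v)) = K.partner f false (m v)) ∧
      ∀ p : E → Momentum, 2 ^ (Finset.univ.filter fun e => f e = .auxiliary).card *
        K.fullWeight f p = ((Equiv.Perm.sign ρ : ℤ) : ℂ) * ∑ i : K.Side true → Fin 2, ∏ v,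
          (quat (p (m v)) * (quat (p (K.partner f false (m v)))).adjugate) (i v) (i (ρ v)) := by
  choose m hm hmu using fun v : K.Side true => hf.existsUnique_forward v
  choose n hn hnu using fun v : K.Side false => hf.existsUnique_forward v
  simp only at hm hmu hn hnu
  have hNS : ∀ v, f (m v) ≠ .scalar := fun v => (hm v).1.1
  let σ : K.Side true ≃ K.Side false :=
    { toFun := fun v => K.endOf false (m v)
      invFun := fun w => K.endOf true (n w)
      left_inv := fun v => by
        change K.endOf true (n (K.endOf false (m v))) = v
        rw [← hnu (K.endOf false (m v)) (m v) ⟨(hm v).1, rfl⟩, (hm v).2]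
      right_inv := fun w => by
        change K.endOf false (m (K.endOf true (n w))) = w
        rw [← hmu (K.endOf true (n w)) (n w) ⟨(hn w).1, rfl⟩, (hn w).2] }
  -- Out along the forward edge of v and back along its fermionic partner (or the same auxiliary
  -- edge): the next chiral vertex on the line.
  let r : K.Side true → K.Side true := fun v => K.endOf true (K.partner f false (m v))
  have hstep : ∀ v, (K.next f)^[2] (m v, true) =
      (K.partner f true (K.partner f false (m v)), true) := fun v => rfl
  have hfw : ∀ e n e', K.Forward f e → (K.next f)^[n] (e, true) = (e', true) →
      K.Forward f e' := by
    intro e n e' he h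
    have h' : K.Reach f (e, true) (e', true) := ⟨n, h⟩
    refine ⟨?_, ?_⟩
    · rw [h'.apply hf he.1]
      exact he.1
    · rw [loopRep_congr (hf.loopOf_eq he.1 h')]
      exact he.2.trans h'
  have hmr : ∀ v, m (r v) = K.partner f true (K.partner f false (m v)) := by
    intro v
    refine (hmu (r v) _ ⟨hfw _ _ _ (hm v).1 (hstep v), ?_⟩).symm
    exact endOf_eq_iff.2 (ends_partner f true _)
  have hr : Function.Injective r := by
    intro v v' h
    have h1 := hmr v
    have hp : ∀ v, f (K.partner f false (m v)) ≠ .scalar := fun v => by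
      rw [hf.apply_partner _ (hNS v)]
      exact hNS v
    rw [h, hmr v'] at h1
    have h2 := congrArg (K.partner f true) h1
    rw [hf.partner_partner _ (hp v), hf.partner_partner _ (hp v')] at h2
    have h3 := congrArg (K.partner f false) h2
    rw [hf.partner_partner _ (hNS v), hf.partner_partner _ (hNS v')] at h3
    rw [← (hm v).2, ← (hm v').2, h3]
  let ρ : Equiv.Perm (K.Side true) := Equiv.ofBijective r (Finite.injective_iff_bijective.1 hr)
  have hρ : ∀ v, ρ v = r v := fun v => rfl
  have hiter : ∀ k v, (K.next f)^[2 * k] (m v, true) = (m (ρ^[k] v), true) := by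
    intro k v
    induction k with
    | zero => rfl
    | succ k ih =>
      rw [Nat.mul_succ, add_comm, Function.iterate_add_apply, ih, hstep,
        Function.iterate_succ_apply' ρ, hρ, hmr]
  refine ⟨m, σ, ρ, fun v => (hm v).2, fun v => rfl, hNS, fun v => ?_, fun p => ?_⟩
  · rw [hρ, hmr, hf.partner_partner]
    rw [hf.apply_partner _ (hNS v)]
    exact hNS v
  have hinj : Function.Injective m := fun v v' h => by rw [← (hm v).2, ← (hm v').2, h]
  have hlen : ∀ v, K.loopLength f (m v, true) = 2 * Function.minimalPeriod ρ v := by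
    intro v
    obtain ⟨k, hk⟩ := even_loopLength (K := K) f (m v, true)
    refine Nat.dvd_antisymm ?_ ?_
    · refine Function.IsPeriodicPt.minimalPeriod_dvd ?_
      change (K.next f)^[_] _ = _
      rw [hiter, Function.iterate_minimalPeriod]
    · rw [hk, ← two_mul]
      refine Nat.mul_dvd_mul_left 2 (Function.IsPeriodicPt.minimalPeriod_dvd ?_)
      have := iterate_loopLength (K := K) f (m v, true)
      rw [hk, ← two_mul, hiter] at this
      exact hinj (congrArg Prod.fst this)
  have hreploop : ∀ v, K.loopOf f (K.loopRep f (m v)) = K.loopOf f (m v) := fun v =>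
    hf.loopOf_eq_of_mem (hNS v) (loopRep_mem f _)
  have hrepfw : ∀ v, K.Forward f (K.loopRep f (m v)) := by
    refine fun v => ⟨?_, ?_⟩
    · rw [hf.apply_of_mem_loopOf (hNS v) (loopRep_mem f _)]
      exact hNS v
    · rw [loopRep_congr (hreploop v)]
      exact Reach.refl _
  -- The cycles of ρ are the loops of nonscalar edges; each is represented by the chiral vertex
  -- whose forward edge is the chosen edge of the loop.
  have hR : ∀ v, ∃! r, r ∈ Finset.univ.filter (fun v => K.loopRep f (m v) = m v) ∧
      ∃ n : ℕ, ρ^[n] r = v := by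
    intro v
    have hv : m (K.endOf true (K.loopRep f (m v))) = K.loopRep f (m v) :=
      (hmu _ _ ⟨hrepfw v, rfl⟩).symm
    refine ⟨K.endOf true (K.loopRep f (m v)), ⟨?_, ?_⟩, ?_⟩
    · rw [Finset.mem_filter, hv]
      exact ⟨Finset.mem_univ _, loopRep_congr (hreploop v)⟩
    · obtain ⟨k, hk⟩ := (hm v).1.2
      have hk2 : Even k := by
        have := iterate_next_snd (K := K) f (K.loopRep f (m v), true) k
        rw [hk] at this
        simpa using this
      obtain ⟨j, rfl⟩ := hk2
      rw [← two_mul, ← hv, hiter] at hk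
      exact ⟨j, hinj (congrArg Prod.fst hk)⟩
    · rintro w ⟨hw, k, rfl⟩
      have h1 : K.loopOf f (m (ρ^[k] w)) = K.loopOf f (m w) :=
        hf.loopOf_eq (s := true) (s' := true) (hNS w) ⟨_, hiter k w⟩
      rw [loopRep_congr h1, (Finset.mem_filter.1 hw).2, (hm w).2]
  have htrans := sign_mul_sum_prod_perm ρ _ hR
    (fun v => quat (p (m v)) * (quat (p (K.partner f false (m v)))).adjugate)
  rw [htrans]
  -- A cycle of length l has sign (-1)^(l-1), and the l backward edges give (-1)^l in the trace. The
  -- remaining minus sign is the one of a fermion loop.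
  have hfac : ∀ v, (-1) ^ (Function.minimalPeriod ρ v - 1) *
      ((List.range (Function.minimalPeriod ρ v)).map fun k => quat (p (m (ρ^[k] v))) *
        (quat (p (K.partner f false (m (ρ^[k] v))))).adjugate).prod.trace =
      -K.loopTrace f p (m v, true) := by
    intro v
    have hpos : 0 < Function.minimalPeriod ρ v :=
      Function.minimalPeriod_pos_of_mem_periodicPts (ρ.injective.mem_periodicPts v)
    rw [loopTrace_eq_of_loopLength (hlen v) fun k => hiter k v]
    obtain ⟨l, hl⟩ : ∃ l, Function.minimalPeriod ρ v = l + 1 := ⟨_, (Nat.sub_add_cancel hpos).symm⟩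
    rw [hl, Nat.add_sub_cancel, pow_succ]
    ring
  simp only [hfac]
  rw [← Finset.prod_filter_mul_prod_filter_not _ fun v => f (m v) = .auxiliary, fullWeight,
    ← mul_assoc, ← Finset.prod_const, ← Finset.prod_mul_distrib]
  congr 1
  · have hfwd : ∀ e, f e = .auxiliary → m (K.endOf true e) = e := fun e he =>
      (hmu _ _ ⟨⟨by simp [he], by rw [hf.loopRep_auxiliary he]; exact Reach.refl _⟩, rfl⟩).symm
    refine Finset.prod_bij' (fun e _ => K.endOf true e) (fun v _ => m v) ?_ ?_ ?_ ?_ ?_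
    · intro e he
      have he' := (Finset.mem_filter.1 he).2
      simp [hfwd e he', hf.loopRep_auxiliary he', he']
    · intro v hv
      exact Finset.mem_filter.2 ⟨Finset.mem_univ _, (Finset.mem_filter.1 hv).2⟩
    · intro e he
      exact hfwd e (Finset.mem_filter.1 he).2
    · intro v _
      exact (hm v).2
    · intro e he
      have he' := (Finset.mem_filter.1 he).2
      rw [hfwd e he', loopTrace_auxiliary hf he']
  · symm
    refine Finset.prod_bij (fun v _ => K.loopOf f (m v)) ?_ ?_ ?_ ?_
    · intro v hv
      exact mem_loops.2 ⟨m v, (ne_scalar_iff.1 (hNS v)).resolve_right (Finset.mem_filter.1 hv).2,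
        rfl⟩
    · intro v hv v' hv' h
      have h1 := (Finset.mem_filter.1 (Finset.mem_filter.1 hv).1).2
      have h2 := (Finset.mem_filter.1 (Finset.mem_filter.1 hv').1).2
      refine hinj ?_
      rw [← h1, ← h2, loopRep_congr h]
    · intro C hC
      obtain ⟨e, he, rfl⟩ := mem_loops.1 hC
      have he' : f e ≠ .scalar := by simp [he]
      have h1 : f (K.loopRep f e) = .fermion := by
        rw [hf.apply_of_mem_loopOf he' (loopRep_mem f _), he]
      have h2 := hf.loopOf_eq_of_mem he' (loopRep_mem f e)
      have h3 : m (K.endOf true (K.loopRep f e)) = K.loopRep f e :=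
        (hmu _ _ ⟨⟨by simp [h1], by rw [loopRep_congr h2]; exact Reach.refl _⟩, rfl⟩).symm
      refine ⟨K.endOf true (K.loopRep f e), ?_, ?_⟩
      · simp [h3, h1, loopRep_congr h2]
      · rw [h3, h2]
    · intro v _
      exact (hf.loopFactor_loopOf (hNS v) true).symm

end CompletedGraph

namespace CompletedGraph

variable {V E : Type*} [Fintype E] {K : CompletedGraph V E} {f : E → Component}

theorem fin_two_eq_or_eq {k k' : Fin 2} (h : k ≠ k') (j : Fin 2) : j = k ∨ j = k' := by
  revert h
  revert j k k'
  decide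

theorem fin_two_add_one_ne (k : Fin 2) : k + 1 ≠ k := by
  revert k
  decide

theorem fin_two_add_self (k : Fin 2) : k + k = 0 := by
  revert k
  decide

/-! ### The slots of a determinant -/

section Slots

variable {g : K.Side true × Fin 2 → E}

open Classical in
/-- The field assignment of a choice of two edges at each chiral vertex: an edge is auxiliary if it
is chosen twice, fermionic if it is chosen once, and scalar otherwise. -/
noncomputable def slotType (K : CompletedGraph V E) (g : K.Side true × Fin 2 → E) (e : E) :
    Component :=
  if ∀ k, g (K.endOf true e, k) = e then .auxiliary
  else if ∃ k, g (K.endOf true e, k) = e then .fermion else .scalar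

omit [Fintype E] in
theorem slotType_of_ne (hg : ∀ s, K.endOf true (g s) = s.1) {s s' : K.Side true × Fin 2}
    (hs : s ≠ s') (h : g s = g s') : K.slotType g (g s) = .auxiliary := by
  have h1 : s.1 = s'.1 := by rw [← hg, ← hg, h]
  obtain ⟨v, k⟩ := s
  obtain ⟨v', k'⟩ := s'
  obtain rfl : v = v' := h1
  rw [slotType, if_pos]
  intro j
  rw [hg]
  have hk : k ≠ k' := fun hk => hs (by rw [hk])
  rcases fin_two_eq_or_eq hk j with rfl | rfl
  · rfl
  · exact h.symm

omit [Fintype E] in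
theorem slotType_of_unique (hg : ∀ s, K.endOf true (g s) = s.1) {s : K.Side true × Fin 2}
    (h : ∀ s', s' ≠ s → g s' ≠ g s) : K.slotType g (g s) = .fermion := by
  rw [slotType, if_neg, if_pos]
  · exact ⟨s.2, by rw [hg]⟩
  · intro h'
    refine h (s.1, s.2 + 1) ?_ ?_
    · exact fun h'' => fin_two_add_one_ne s.2 (congrArg Prod.snd h'')
    · rw [← hg s]
      exact h' _

omit [Fintype E] in
theorem slotType_of_forall_ne {e : E} (h : ∀ s, g s ≠ e) : K.slotType g e = .scalar := by
  rw [slotType, if_neg (fun h' => h _ (h' 0)), if_neg]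
  rintro ⟨k, hk⟩
  exact h _ hk

omit [Fintype E] in
theorem slotType_ne_scalar (hg : ∀ s, K.endOf true (g s) = s.1) (s : K.Side true × Fin 2) :
    K.slotType g (g s) ≠ .scalar := by
  rw [slotType]
  split_ifs with h1 h2
  · simp
  · simp
  · exact absurd ⟨s.2, by rw [hg]⟩ h2

/-- Two slots at a vertex either share an edge, giving the interaction with one auxiliary field, or
lie on two edges, giving the one with two fermions; the remaining edges are scalar. -/
theorem isAssignment_slotType (hg : ∀ s, K.endOf true (g s) = s.1)
    (h : ∀ v, ∃ s s', s ≠ s' ∧ ∀ t, g t ∈ K.incident v ↔ t = s ∨ t = s') :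
    K.IsAssignment (K.slotType g) := by
  refine K.isAssignment_iff.2 fun v => ?_
  obtain ⟨s, s', hs, h⟩ := h v
  have h1 : g s ∈ K.incident v := (h s).2 (Or.inl rfl)
  have h2 : g s' ∈ K.incident v := (h s').2 (Or.inr rfl)
  refine ⟨g s, h1, g s', h2, ?_, ?_⟩
  · by_cases hss : g s = g s'
    · exact Or.inl ⟨hss, slotType_of_ne hg hs hss⟩
    · refine Or.inr ⟨hss, slotType_of_unique hg ?_, slotType_of_unique hg ?_⟩
      · intro t ht h'
        rcases (h t).1 (h' ▸ h1) with rfl | rfl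
        · exact ht rfl
        · exact hss h'.symm
      · intro t ht h'
        rcases (h t).1 (h' ▸ h2) with rfl | rfl
        · exact hss h'
        · exact ht rfl
  · intro z hz hz1 hz2
    refine slotType_of_forall_ne fun t ht => ?_
    subst ht
    rcases (h t).1 hz with rfl | rfl
    · exact hz1 rfl
    · exact hz2 rfl

end Slots

section Expansion

variable [Fintype V] (e₀ : K.Side true ≃ K.Side false)

/-- The antichiral end of an edge, in terms of a pairing of the vertices. -/
def colOf (e : E) : K.Side true := e₀.symm (K.endOf false e)

open Classical in
/-- The matrix of the chiral Dirac operator on the graph: its block at a chiral and an antichiral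
vertex is the sum of the momenta, as quaternions, on the edges between these vertices. -/
noncomputable def diracMatrix (p : E → Momentum) :
    Matrix (K.Side true × Fin 2) (K.Side true × Fin 2) ℂ :=
  Matrix.of fun r c => ∑ e with K.endOf true e = r.1 ∧ colOf e₀ e = c.1, quat (p e) r.2 c.2

/-- A permutation and a choice of edges which contribute to the expanded determinant. -/
def Compatible (x : Equiv.Perm (K.Side true × Fin 2) × (K.Side true × Fin 2 → E)) : Prop :=
  (∀ s, K.endOf true (x.2 s) = s.1) ∧ ∀ s, colOf e₀ (x.2 s) = (x.1 s).1

open Classical in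
/-- A term of the expanded determinant. -/
noncomputable def slotTerm (p : E → Momentum)
    (x : Equiv.Perm (K.Side true × Fin 2) × (K.Side true × Fin 2 → E)) : ℂ :=
  ((Equiv.Perm.sign x.1 : ℤ) : ℂ) * ∏ s, quat (p (x.2 s)) s.2 (x.1 s).2

-- Leibniz formula with permutations from rows to columns (hence the transposition), where each
-- entry is multiplied out into a choice of one edge per row.
open Classical in
theorem det_diracMatrix_eq_sum_compatible (p : E → Momentum) :
    (diracMatrix e₀ p).det = ∑ x with Compatible e₀ x, slotTerm p x := by
  rw [← Matrix.det_transpose, Matrix.det_apply', Finset.sum_filter, Fintype.sum_prod_type]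
  refine Finset.sum_congr rfl fun τ _ => ?_
  simp only [Matrix.transpose_apply, diracMatrix, Matrix.of_apply]
  rw [Finset.prod_univ_sum, Finset.mul_sum, ← Finset.sum_filter]
  refine Finset.sum_congr ?_ fun g _ => rfl
  ext g
  simp [Compatible, Fintype.mem_piFinset, forall_and]

-- A chiral vertex has two rows and an antichiral vertex two columns, so exactly two slots meet each
-- vertex.
omit [Fintype V] in
theorem Compatible.isAssignment
    {x : Equiv.Perm (K.Side true × Fin 2) × (K.Side true × Fin 2 → E)}
    (hx : Compatible e₀ x) : K.IsAssignment (K.slotType x.2) := by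
  obtain ⟨τ, g⟩ := x
  obtain ⟨h1, h2⟩ := hx
  simp only at h1 h2 ⊢
  have hfin : ∀ k : Fin 2, k = 0 ∨ k = 1 := by decide
  refine isAssignment_slotType h1 fun v => ?_
  rcases hv : K.chirality v with _ | _
  · obtain ⟨w, hw⟩ : ∃ w, w = e₀.symm ⟨v, hv⟩ := ⟨_, rfl⟩
    refine ⟨τ.symm (w, 0), τ.symm (w, 1), by simp, fun t => ?_⟩
    have h3 : g t ∈ K.incident v ↔ (τ t).1 = w := by
      rw [mem_incident, hv, ← h2, colOf, hw, e₀.symm.injective.eq_iff, Subtype.ext_iff]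
      rfl
    rw [h3, Equiv.eq_symm_apply, Equiv.eq_symm_apply, Prod.ext_iff, Prod.ext_iff, ← and_or_left]
    exact ⟨fun h => ⟨h, hfin _⟩, fun h => h.1⟩
  · refine ⟨(⟨v, hv⟩, 0), (⟨v, hv⟩, 1), by simp, fun t => ?_⟩
    have h3 : g t ∈ K.incident v ↔ t.1 = ⟨v, hv⟩ := by
      rw [mem_incident, hv, ← h1, Subtype.ext_iff]
      rfl
    rw [h3, Prod.ext_iff, Prod.ext_iff, ← and_or_left]
    exact ⟨fun h => ⟨h, hfin _⟩, fun h => h.1⟩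

end Expansion

/-! ### The slots of a fixed field assignment -/

section FixedAssignment

variable {S : Type*}

/-- Shift of the spinor index. -/
def spinShift (i : S → Fin 2) : Equiv.Perm (S × Fin 2) :=
  Equiv.prodCongrRight fun v => Equiv.addRight (i v)

/-- The permutation of slots attached to a matching `θ`, a permutation `ρ` which follows the
fermion lines, and spinor indices `i`, `j`. -/
def slotPerm (θ ρ : Equiv.Perm S) (i j : S → Fin 2) : Equiv.Perm (S × Fin 2) :=
  Equiv.prodCongrLeft (fun _ => θ) * (spinShift j *
    (Equiv.prodCongrLeft (fun k : Fin 2 => if k = 0 then 1 else ρ⁻¹) * spinShift i))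

theorem slotPerm_apply_self (θ ρ : Equiv.Perm S) (i j : S → Fin 2) (v : S) :
    slotPerm θ ρ i j (v, i v) = (θ v, j v) := by
  simp [slotPerm, spinShift, fin_two_add_self]

/-- The backward edge leading from column block `θ v` to the next vertex `ρ v` takes the row and the
column that the forward edges leave free. -/
theorem slotPerm_apply_add_one (θ ρ : Equiv.Perm S) (i j : S → Fin 2) (v : S) :
    slotPerm θ ρ i j (ρ v, i (ρ v) + 1) = (θ v, j v + 1) := by
  have h : i (ρ v) + 1 + i (ρ v) = 1 := by
    rw [add_right_comm, fin_two_add_self, zero_add]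
  simp [slotPerm, spinShift, h]
  exact add_comm _ _

/-- θ acts on both spinor values and contributes a square; ρ⁻¹ acts on one of them only; each spin
shift is a product of transpositions. -/
theorem sign_slotPerm [Fintype S] [DecidableEq S] (θ ρ : Equiv.Perm S) (i j : S → Fin 2) :
    Equiv.Perm.sign (slotPerm θ ρ i j) =
      Equiv.Perm.sign ρ * ∏ v, ((-1) ^ (i v : ℕ) * (-1) ^ (j v : ℕ)) := by
  have h : ∀ k : Fin 2, Equiv.Perm.sign (Equiv.addRight k) = (-1) ^ (k : ℕ) := by decide
  simp only [slotPerm, spinShift, Equiv.Perm.sign_mul, Equiv.Perm.sign_prodCongrRight,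
    Equiv.Perm.sign_prodCongrLeft, h, Finset.prod_mul_distrib]
  simp
  ac_rfl

/-- The edges in the slots. -/
def slotEdge {E : Type*} (a b : S → E) (i : S → Fin 2) (s : S × Fin 2) : E :=
  if s.2 = i s.1 then a s.1 else b s.1

end FixedAssignment

end CompletedGraph

namespace CompletedGraph

variable {V E : Type*} [Fintype E] {K : CompletedGraph V E} {f : E → Component}

omit [Fintype E] in
theorem slotEdge_self {S : Type*} (a b : S → E) (i : S → Fin 2) (v : S) :
    slotEdge a b i (v, i v) = a v := if_pos rfl

omit [Fintype E] in
theorem slotEdge_add_one {S : Type*} (a b : S → E) (i : S → Fin 2) (v : S) :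
    slotEdge a b i (v, i v + 1) = b v := if_neg (fin_two_add_one_ne _)

open Classical in
omit [Fintype E] in
theorem slotType_congr {g : K.Side true × Fin 2 → E} (i : K.Side true → Fin 2) (e : E) :
    K.slotType g e = if g (K.endOf true e, i (K.endOf true e)) = e ∧
      g (K.endOf true e, i (K.endOf true e) + 1) = e then .auxiliary
      else if g (K.endOf true e, i (K.endOf true e)) = e ∨
        g (K.endOf true e, i (K.endOf true e) + 1) = e then .fermion else .scalar := by
  have h : ∀ P : Fin 2 → Prop, ∀ k, ((∀ l, P l) ↔ P k ∧ P (k + 1)) ∧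
      ((∃ l, P l) ↔ P k ∨ P (k + 1)) := by
    intro P k
    have hk : ∀ l, l = k ∨ l = k + 1 := fin_two_eq_or_eq (fin_two_add_one_ne k).symm
    refine ⟨⟨fun h => ⟨h _, h _⟩, fun h l => ?_⟩, ⟨?_, ?_⟩⟩
    · rcases hk l with rfl | rfl
      exacts [h.1, h.2]
    · rintro ⟨l, hl⟩
      rcases hk l with rfl | rfl
      exacts [Or.inl hl, Or.inr hl]
    · rintro (h | h)
      exacts [⟨_, h⟩, ⟨_, h⟩]
  unfold slotType
  simp only [h (fun l => g (K.endOf true e, l) = e) (i (K.endOf true e))]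

theorem prod_fin_two_shift {A : Type*} [CommMonoid A] (h : Fin 2 → A) (k : Fin 2) :
    ∏ l, h l = h k * h (k + 1) := by
  rw [Fin.prod_univ_two]
  fin_cases k
  · rfl
  · exact mul_comm _ _

/-- These signs are the ones produced by the spin shifts in `sign_slotPerm`, so the complementary
entries of the backward edges become adjugates. -/
theorem adjugate_fin_two_apply (B : Matrix (Fin 2) (Fin 2) ℂ) (k l : Fin 2) :
    B.adjugate k l = (-1) ^ (k : ℕ) * (-1) ^ (l : ℕ) * B (l + 1) (k + 1) := by
  rw [Matrix.adjugate_fin_two]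
  fin_cases k <;> fin_cases l <;> simp

/-! ### The determinant terms of one field assignment -/

section

variable [Fintype V] (e₀ : K.Side true ≃ K.Side false) {m : K.Side true → E}
  {θ ρ : Equiv.Perm (K.Side true)}

omit [Fintype V] in
theorem compatible_slot (h1 : ∀ v, K.endOf true (m v) = v)
    (h2 : ∀ v, colOf e₀ (m v) = θ v)
    (h4 : ∀ v, K.partner f true (m (ρ v)) = K.partner f false (m v)) (i j : K.Side true → Fin 2) :
    Compatible e₀ (slotPerm θ ρ i j, slotEdge m (fun v => K.partner f true (m v)) i) := by
  constructor
  · rintro ⟨v, k⟩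
    rcases fin_two_eq_or_eq (fin_two_add_one_ne (i v)) k with rfl | rfl
    · simp only [slotEdge_add_one]
      exact (endOf_eq_iff.2 (ends_partner f true _)).trans (h1 v)
    · simp only [slotEdge_self, h1]
  · rintro ⟨v, k⟩
    rcases fin_two_eq_or_eq (fin_two_add_one_ne (i v)) k with rfl | rfl
    · obtain ⟨u, rfl⟩ := ρ.surjective v
      simp only [slotEdge_add_one, slotPerm_apply_add_one, h4]
      rw [← h2, colOf, endOf_eq_iff.2 (ends_partner f false (m u))]
      rfl
    · simp only [slotEdge_self, slotPerm_apply_self, h2]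

omit [Fintype V] in
theorem slotType_slotEdge (hf : K.IsAssignment f) (h1 : ∀ v, K.endOf true (m v) = v)
    (h3 : ∀ v, f (m v) ≠ .scalar) (i : K.Side true → Fin 2) :
    K.slotType (slotEdge m (fun v => K.partner f true (m v)) i) = f := by
  funext e
  rw [slotType_congr i, slotEdge_self, slotEdge_add_one]
  have h3' := h3 (K.endOf true e)
  have hap := hf.apply_partner true h3'
  by_cases he : f e = .scalar
  · rw [if_neg, if_neg, he]
    · rintro (h | h)
      · exact h3' (by rw [h, he])
      · exact h3' (by rw [← hap, h, he])
    · rintro ⟨h, -⟩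
      exact h3' (by rw [h, he])
  · have h5 := hf.eq_or_eq_partner (s := true) h3' he (endOf_eq_iff.1 (h1 _).symm)
    have hfe : f e = f (m (K.endOf true e)) := by
      rcases h5 with h | h
      · exact congrArg f h
      · exact (congrArg f h).trans hap
    rcases ne_scalar_iff.1 he with h | h
    · have h6 := hf.partner_ne true (hfe ▸ h)
      rw [if_neg, if_pos, h]
      · exact h5.imp Eq.symm Eq.symm
      · rintro ⟨h7, h8⟩
        exact h6 (h8.trans h7.symm)
    · have h6 := hf.partner_auxiliary true (hfe ▸ h)
      rw [h6, or_self] at h5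
      rw [h6, if_pos ⟨h5.symm, h5.symm⟩, h]

-- The rows of the forward edges fix the term: the other row of each vertex takes the other
-- nonscalar edge, the edges fix the column blocks, and the spinor columns of the backward edges are
-- the ones left free.
omit [Fintype V] in
theorem slot_eq_of_compatible (hf : K.IsAssignment f) (h1 : ∀ v, K.endOf true (m v) = v)
    (h2 : ∀ v, colOf e₀ (m v) = θ v) (h3 : ∀ v, f (m v) ≠ .scalar)
    (h4 : ∀ v, K.partner f true (m (ρ v)) = K.partner f false (m v))
    {x : Equiv.Perm (K.Side true × Fin 2) × (K.Side true × Fin 2 → E)}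
    (hx : Compatible e₀ x) (hxf : K.slotType x.2 = f) {i : K.Side true → Fin 2}
    (hi : ∀ v, x.2 (v, i v) = m v) :
    (slotPerm θ ρ i (fun v => (x.1 (v, i v)).2),
      slotEdge m (fun v => K.partner f true (m v)) i) = x := by
  obtain ⟨τ, g⟩ := x
  simp only at hi hxf ⊢
  have hg : slotEdge m (fun v => K.partner f true (m v)) i = g := by
    funext ⟨v, k⟩
    rcases fin_two_eq_or_eq (fin_two_add_one_ne (i v)) k with rfl | rfl
    · rw [slotEdge_add_one]
      have hns := slotType_ne_scalar hx.1 (v, i v + 1)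
      simp only [hxf] at hns
      have hend : K.ends true (g (v, i v + 1)) = K.ends true (m v) :=
        endOf_eq_iff.1 ((hx.1 (v, i v + 1)).trans (h1 v).symm)
      rcases hf.eq_or_eq_partner (h3 v) hns hend with h | h
      · have haux := slotType_of_ne (s := (v, i v)) (s' := (v, i v + 1)) hx.1
          (fun h' => fin_two_add_one_ne _ (congrArg Prod.snd h').symm) ((hi v).trans h.symm)
        simp only [hxf, hi] at haux
        rw [h, hf.partner_auxiliary true haux]
      · exact h.symm
    · rw [slotEdge_self, hi]
  have hcol : ∀ s, (slotPerm θ ρ i (fun v => (τ (v, i v)).2) s).1 = (τ s).1 := by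
    intro s
    rw [← (compatible_slot e₀ h1 h2 h4 i _).2 s, ← hx.2 s, hg]
  have hself : ∀ v, slotPerm θ ρ i (fun v => (τ (v, i v)).2) (v, i v) = τ (v, i v) := by
    intro v
    refine Prod.ext (hcol _) ?_
    rw [slotPerm_apply_self]
  refine Prod.ext (Equiv.ext ?_) hg
  rintro ⟨v, k⟩
  rcases fin_two_eq_or_eq (fin_two_add_one_ne (i v)) k with rfl | rfl
  · obtain ⟨u, rfl⟩ := ρ.surjective v
    refine Prod.ext (hcol _) ?_
    rw [slotPerm_apply_add_one]
    have hne : (τ (u, i u)).2 ≠ (τ (ρ u, i (ρ u) + 1)).2 := by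
      intro h
      have h5 : τ (u, i u) = τ (ρ u, i (ρ u) + 1) := by
        refine Prod.ext ?_ h
        rw [← hcol, ← hcol, slotPerm_apply_self, slotPerm_apply_add_one]
      have h6 := τ.injective h5
      have h7 : u = ρ u := congrArg Prod.fst h6
      have h8 : i u = i (ρ u) + 1 := congrArg Prod.snd h6
      rw [← h7] at h8
      exact fin_two_add_one_ne _ h8.symm
    exact (fin_two_eq_or_eq hne _).resolve_left (fin_two_add_one_ne _)
  · exact hself v

-- Rows are grouped into forward and backward edges. The signs of the permutation, with i reindexed
-- along ρ, are absorbed into the adjugates of the backward edges.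
open Classical in
theorem slotTerm_slot 
    (h4 : ∀ v, K.partner f true (m (ρ v)) = K.partner f false (m v)) (i j : K.Side true → Fin 2)
    (p : E → Momentum) :
    slotTerm p (slotPerm θ ρ i j, slotEdge m (fun v => K.partner f true (m v)) i) =
      ((Equiv.Perm.sign ρ : ℤ) : ℂ) * ∏ v, (quat (p (m v)) (i v) (j v) *
        (quat (p (K.partner f false (m v)))).adjugate (j v) (i (ρ v))) := by
  have h5 : ∏ s, quat (p (slotEdge m (fun v => K.partner f true (m v)) i s)) s.2
      (slotPerm θ ρ i j s).2 = (∏ v, quat (p (m v)) (i v) (j v)) *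
        ∏ v, quat (p (K.partner f false (m v))) (i (ρ v) + 1) (j v + 1) := by
    rw [Fintype.prod_prod_type]
    simp only [fun v : K.Side true => prod_fin_two_shift (fun k =>
      quat (p (slotEdge m (fun v => K.partner f true (m v)) i (v, k))) k
        (slotPerm θ ρ i j (v, k)).2) (i v)]
    rw [Finset.prod_mul_distrib]
    congr 1
    · simp only [slotEdge_self, slotPerm_apply_self]
    · rw [← Equiv.prod_comp ρ]
      simp only [slotEdge_add_one, slotPerm_apply_add_one, h4]
  have h6 : ∏ v, (-1 : ℂ) ^ (i v : ℕ) = ∏ v, (-1 : ℂ) ^ (i (ρ v) : ℕ) :=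
    (Equiv.prod_comp ρ fun v => (-1 : ℂ) ^ (i v : ℕ)).symm
  simp only [slotTerm, h5, sign_slotPerm, adjugate_fin_two_apply]
  push_cast
  simp only [Finset.prod_mul_distrib, h6]
  ring

-- An auxiliary edge fills both rows of its chiral vertex, so either may be called the forward one;
-- at all other vertices the row is forced.
open Classical in
theorem card_slot (hf : K.IsAssignment f) (h1 : ∀ v, K.endOf true (m v) = v)
    (h3 : ∀ v, f (m v) ≠ .scalar) {g : K.Side true × Fin 2 → E}
    (hg : ∀ s, K.endOf true (g s) = s.1) (hgf : K.slotType g = f) :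
    (Finset.univ.filter fun i : K.Side true → Fin 2 => ∀ v, g (v, i v) = m v).card =
      2 ^ (Finset.univ.filter fun e => f e = .auxiliary).card := by
  have hpi : (Finset.univ.filter fun i : K.Side true → Fin 2 => ∀ v, g (v, i v) = m v) =
      Fintype.piFinset fun v => Finset.univ.filter fun k => g (v, k) = m v := by
    ext i
    simp [Fintype.mem_piFinset]
  have hcard : ∀ v, (Finset.univ.filter fun k => g (v, k) = m v).card =
      if f (m v) = .auxiliary then 2 else 1 := by
    intro v
    have hv := congrFun hgf (m v)
    split_ifs with haux
    · rw [haux] at hv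
      unfold slotType at hv
      split_ifs at hv with h
      rw [h1] at h
      rw [Finset.filter_true_of_mem fun k _ => h k]
      rfl
    · have hex : ∃ k, g (v, k) = m v := by
        by_contra hne
        unfold slotType at hv
        rw [h1, if_neg fun h => hne ⟨0, h 0⟩, if_neg hne] at hv
        exact h3 v hv.symm
      obtain ⟨k, hk⟩ := hex
      refine Finset.card_eq_one.2 ⟨k, ?_⟩
      ext l
      simp only [Finset.mem_filter, Finset.mem_univ, true_and, Finset.mem_singleton]
      refine ⟨fun hl => ?_, fun hl => hl ▸ hk⟩
      by_contra hlk
      have := slotType_of_ne (s := (v, k)) (s' := (v, l)) hg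
        (fun h => hlk (congrArg Prod.snd h).symm) (hk.trans hl.symm)
      rw [hk, hgf] at this
      exact haux this
  have hm : ∀ e, f e = .auxiliary → m (K.endOf true e) = e := by
    intro e he
    have h := hf.eq_or_eq_partner (s := true) (by simp [he]) (h3 _)
      (endOf_eq_iff.1 (h1 (K.endOf true e)))
    rwa [hf.partner_auxiliary true he, or_self] at h
  rw [hpi, Fintype.card_piFinset]
  simp only [hcard]
  rw [Finset.prod_ite, Finset.prod_const_one, mul_one, Finset.prod_const]
  congr 1
  refine Finset.card_bij' (fun v _ => m v) (fun e _ => K.endOf true e) ?_ ?_ ?_ ?_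
  · intro v hv
    simpa using hv
  · intro e he
    have he' := (Finset.mem_filter.1 he).2
    simp [hm e he', he']
  · intro v _
    exact h1 v
  · intro e he
    exact hm e (Finset.mem_filter.1 he).2

-- The spinor indices (i, j) of the oriented loops map onto the terms of `f`, and each term is hit
-- once per choice of rows counted by `card_slot`. This overcounting equals the power of two in
-- `exists_orientation`, and the sum over j restores the matrix products.
open Classical in
theorem sum_compatible_eq_fullWeight (hf : K.IsAssignment f) (p : E → Momentum) :
    ∑ x with Compatible e₀ x ∧ K.slotType x.2 = f, slotTerm p x = K.fullWeight f p := by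
  obtain ⟨m, σ, ρ, h1, h2, h3, h4, h5⟩ := hf.exists_orientation
  let θ : Equiv.Perm (K.Side true) := σ.trans e₀.symm
  have hθ : ∀ v, colOf e₀ (m v) = θ v := fun v => by rw [colOf, h2]; rfl
  refine mul_left_cancel₀ (pow_ne_zero
    (Finset.univ.filter fun e => f e = .auxiliary).card (two_ne_zero (α := ℂ))) ?_
  rw [h5 p]
  let Ψ : (K.Side true → Fin 2) × (K.Side true → Fin 2) →
      Equiv.Perm (K.Side true × Fin 2) × (K.Side true × Fin 2 → E) := fun ij =>
    (slotPerm θ ρ ij.1 ij.2, slotEdge m (fun v => K.partner f true (m v)) ij.1)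
  have hmaps : ∀ ij ∈ Finset.univ, Ψ ij ∈
      Finset.univ.filter fun x => Compatible e₀ x ∧ K.slotType x.2 = f := fun ij _ =>
    Finset.mem_filter.2 ⟨Finset.mem_univ _, compatible_slot e₀ h1 hθ h4 _ _,
      slotType_slotEdge hf h1 h3 _⟩
  have hfib : ∀ x ∈ Finset.univ.filter fun x => Compatible e₀ x ∧ K.slotType x.2 = f,
      ∑ ij with Ψ ij = x, slotTerm p (Ψ ij) =
        2 ^ (Finset.univ.filter fun e => f e = .auxiliary).card * slotTerm p x := by
    intro x hx
    obtain ⟨hc, hxf⟩ := (Finset.mem_filter.1 hx).2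
    rw [Finset.sum_congr rfl fun ij hij => congrArg (slotTerm p) (Finset.mem_filter.1 hij).2,
      Finset.sum_const, nsmul_eq_mul, ← Nat.cast_ofNat (R := ℂ) (n := 2), ← Nat.cast_pow,
      ← card_slot hf h1 h3 hc.1 hxf]
    congr 2
    refine (Finset.card_bij' (fun ij _ => ij.1)
      (fun i _ => (i, fun v => (x.1 (v, i v)).2)) ?_ ?_ ?_ ?_)
    · intro ij hij
      simp only [Finset.mem_filter, Finset.mem_univ, true_and] at hij ⊢
      subst hij
      intro v
      simp only [Ψ, slotEdge_self]
    · intro i hi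
      simp only [Finset.mem_filter, Finset.mem_univ, true_and] at hi ⊢
      exact slot_eq_of_compatible e₀ hf h1 hθ h3 h4 hc hxf hi
    · intro ij hij
      simp only [Finset.mem_filter, Finset.mem_univ, true_and] at hij
      subst hij
      refine Prod.ext rfl ?_
      funext v
      simp only [Ψ, slotPerm_apply_self]
    · intro i _
      rfl
  rw [Finset.mul_sum, ← Finset.sum_congr rfl hfib, Finset.sum_fiberwise_of_maps_to hmaps,
    Fintype.sum_prod_type, Finset.mul_sum]
  refine Finset.sum_congr rfl fun i _ => ?_
  simp only [Ψ, slotTerm_slot h4]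
  rw [← Finset.mul_sum]
  congr 1
  simp only [Matrix.mul_apply]
  rw [Finset.prod_univ_sum, Fintype.piFinset_univ]

open Classical in
/-- The summed numerator of all field assignments is the determinant of the chiral
Dirac operator. -/
theorem sum_fullWeight_eq_det (p : E → Momentum) :
    ∑ f with K.IsAssignment f, K.fullWeight f p = (diracMatrix e₀ p).det := by
  rw [det_diracMatrix_eq_sum_compatible,
    ← Finset.sum_fiberwise_of_maps_to (s := Finset.univ.filter fun x => Compatible e₀ x)
      (t := Finset.univ.filter fun f => K.IsAssignment f)
      (g := fun x => K.slotType x.2)]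
  · refine Finset.sum_congr rfl fun f hf => ?_
    rw [← sum_compatible_eq_fullWeight e₀ (Finset.mem_filter.1 hf).2, Finset.filter_filter]
  · intro x hx
    exact Finset.mem_filter.2 ⟨Finset.mem_univ _, (Finset.mem_filter.1 hx).2.isAssignment⟩

end

end CompletedGraph
end WessZumino

/-! ### Cofactors of the Dirac matrix and the two-point functions -/

namespace WessZumino
open scoped Matrix

/-- Polynomial dependence of a block cofactor: its degree is bounded by the number of columns,
other than those of the removed block, in which the perturbation lives. -/
theorem exists_polynomial_det_add_singleBlock {ι κ : Type*} [Fintype ι] [DecidableEq ι] [Fintype κ]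
    [DecidableEq κ] {A B : Matrix (ι × κ) (ι × κ) ℂ} (hA : ∀ r k, ∑ w, A r (w, k) = 0)
    (hB : ∀ r k, ∑ w, B r (w, k) = 0) (a : ι) {b : ι} {U : Finset ι} (hb : b ∈ U)
    (hBU : ∀ r c, c.1 ∉ U → B r c = 0) :
    ∃ P : Polynomial ℂ, P.natDegree ≤ Fintype.card κ * (U.card - 1) ∧
      ∀ t : ℂ, P.eval t = (A + t • B + singleBlock a b 1).det := by
  classical
  -- Block column b is cleared beforehand, as `det_add_singleBlock_one_col` permits; this removes
  -- one block column from the degree count.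
  let M : Matrix (ι × κ) (ι × κ) (Polynomial ℂ) := Matrix.of fun r c =>
    (if c.1 = b then 0 else Polynomial.C (A r c) + Polynomial.C (B r c) * Polynomial.X) +
      Polynomial.C (singleBlock a b 1 r c)
  let D : ι → ℕ := fun v => if v ∈ U.erase b then 1 else 0
  refine ⟨M.det, ?_, fun t => ?_⟩
  · refine (natDegree_det_le M (fun c => D c.1) fun r c => ?_).trans ?_
    · simp only [M, Matrix.of_apply]
      refine Polynomial.natDegree_add_le_of_degree_le ?_ (by simp)
      by_cases hc : c.1 = b
      · simp [hc]
      · by_cases hU : c.1 ∈ U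
        · simp only [D]
          rw [if_neg hc, if_pos (Finset.mem_erase.2 ⟨hc, hU⟩)]
          refine Polynomial.natDegree_add_le_of_degree_le (by simp) ?_
          exact (Polynomial.natDegree_C_mul_le _ _).trans Polynomial.natDegree_X_le
        · simp [hc, hBU r c hU, D]
    · rw [Fintype.sum_prod_type_right, ← Finset.card_erase_of_mem hb]
      simp only [Finset.sum_const, D, Finset.card_univ, smul_eq_mul]
      rw [Finset.sum_boole, Finset.filter_mem_eq_inter, Finset.univ_inter]
      rfl
  · have hAB : ∀ r k, ∑ w, (A + t • B) r (w, k) = 0 := fun r k => by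
      simp [Finset.sum_add_distrib, ← Finset.mul_sum, hA, hB]
    rw [det_add_singleBlock_one_col hAB, ← Polynomial.coe_evalRingHom, RingHom.map_det]
    congr 1
    ext r c
    simp only [M, RingHom.mapMatrix_apply, Matrix.map_apply, Matrix.of_apply,
      Polynomial.coe_evalRingHom]
    split_ifs <;> simp [mul_comm t]

namespace CompletedGraph

variable {V E : Type*} [Fintype E] {K : CompletedGraph V E} {p k : E → Momentum}

/-- Counting edges by their ends of chirality `s`. Both chiralities thus have equally many vertices,
and the Dirac matrix can be made square. -/
theorem card_side_mul_three [Fintype V] (s : Bool) :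
    Fintype.card (K.Side s) * 3 = Fintype.card E := by
  classical
  rw [← Finset.card_univ (α := E), Finset.card_eq_sum_card_fiberwise (f := K.endOf s)
    (t := Finset.univ) (fun _ _ => Finset.mem_coe.2 (Finset.mem_univ _)), ← Finset.card_univ,
    ← smul_eq_mul, ← Finset.sum_const]
  refine Finset.sum_congr rfl fun v _ => ?_
  rw [← K.card_incident v.1]
  congr 1
  ext e
  rw [mem_incident, v.2, Finset.mem_filter, Subtype.ext_iff]
  simp [endOf]

section Matrix

variable [Fintype V] (e₀ : K.Side true ≃ K.Side false)

omit [Fintype V] in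
theorem diracMatrix_add (p q : E → Momentum) :
    diracMatrix e₀ (p + q) = diracMatrix e₀ p + diracMatrix e₀ q := by
  ext r c
  simp [diracMatrix, quat_add, Finset.sum_add_distrib]

omit [Fintype V] in
theorem diracMatrix_smul (t : ℝ) (p : E → Momentum) :
    diracMatrix e₀ (t • p) = (t : ℂ) • diracMatrix e₀ p := by
  ext r c
  simp [diracMatrix, quat_smul, Finset.mul_sum]

open Classical in
omit [Fintype V] in
theorem diracMatrix_single (e : E) (Y : Momentum) : diracMatrix e₀ (Pi.single e Y) =
    singleBlock (K.endOf true e) (colOf e₀ e) (quat Y) := by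
  ext r c
  rw [singleBlock_apply, diracMatrix, Matrix.of_apply, Finset.sum_filter,
    Finset.sum_eq_single e]
  · simp [eq_comm]
  · intro e' _ he'
    simp [Pi.single_eq_of_ne he', quat_zero]
  · simp

open Classical in
omit [Fintype V] in
theorem diracMatrix_update (p : E → Momentum) (e : E) (X : Momentum) :
    diracMatrix e₀ (Function.update p e X) = diracMatrix e₀ p +
      singleBlock (K.endOf true e) (colOf e₀ e) (quat (X - p e)) := by
  rw [← diracMatrix_single, ← diracMatrix_add]
  congr 1
  ext e' : 1
  by_cases h : e' = e
  · subst h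
    simp
  · simp [h]

omit [Fintype V] in
theorem IsFlow.sum_quat (hp : K.IsFlow p) {s : Bool} (v : K.Side s) (i j : Fin 2) :
    ∑ e ∈ K.incident v.1, quat (p e) i j = 0 := by
  have := congrArg quat (hp v.1)
  rw [quat_sum, quat_zero] at this
  simpa [Matrix.sum_apply] using congrFun (congrFun this i) j

/-- Row sums vanish by conservation at the chiral vertices, column sums by conservation at the
antichiral ones. -/
theorem IsFlow.sum_row (hp : K.IsFlow p) (r : K.Side true × Fin 2) (k : Fin 2) :
    ∑ w, diracMatrix e₀ p r (w, k) = 0 := by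
  classical
  rw [← hp.sum_quat r.1 r.2 k]
  simp only [diracMatrix, Matrix.of_apply, Finset.sum_filter]
  rw [Finset.sum_comm]
  simp only [ite_and, Finset.sum_ite_irrel, Finset.sum_ite_eq, Finset.sum_const_zero,
    Finset.mem_univ, if_true]
  rw [← Finset.sum_filter]
  refine Finset.sum_congr ?_ fun _ _ => rfl
  ext e
  rw [mem_incident, r.1.2, Finset.mem_filter, Subtype.ext_iff]
  simp [endOf]

theorem IsFlow.sum_col (hp : K.IsFlow p) (c : K.Side true × Fin 2) (k : Fin 2) :
    ∑ v, diracMatrix e₀ p (v, k) c = 0 := by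
  classical
  rw [← hp.sum_quat (e₀ c.1) k c.2]
  simp only [diracMatrix, Matrix.of_apply, Finset.sum_filter]
  rw [Finset.sum_comm]
  simp only [and_comm (a := K.endOf true _ = _)]
  simp only [ite_and, Finset.sum_ite_irrel, Finset.sum_ite_eq, Finset.sum_const_zero,
    Finset.mem_univ, if_true]
  rw [← Finset.sum_filter]
  refine Finset.sum_congr ?_ fun _ _ => rfl
  ext e
  rw [mem_incident, (e₀ c.1).2, Finset.mem_filter, colOf, Equiv.symm_apply_eq, Subtype.ext_iff]
  simp [endOf]

open Classical in
/-- The determinant, as a function of the momentum on one edge. -/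
theorem IsFlow.det_update (hp : K.IsFlow p) (e : E) (X : Momentum) (a b : K.Side true) :
    (diracMatrix e₀ (Function.update p e X)).det =
      (((X - p e) ⬝ᵥ (X - p e) : ℝ) : ℂ) * (diracMatrix e₀ p + singleBlock a b 1).det := by
  rw [diracMatrix_update, det_add_singleBlock (hp.sum_row e₀) (hp.sum_col e₀) _ _ a b, quat_det]

end Matrix

theorem sum_component {A : Type*} [AddCommMonoid A] (h : Component → A) :
    ∑ c, h c = h .scalar + (h .fermion + h .auxiliary) := by
  have : (Finset.univ : Finset Component) = {.scalar, .fermion, .auxiliary} := rfl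
  rw [this, Finset.sum_insert (by simp), Finset.sum_insert (by simp), Finset.sum_singleton]

theorem mem_assignments {e : E} {c : Component} {f : E → Component} :
    f ∈ K.assignments e c ↔ K.IsAssignment f ∧ f e = c := by
  simp [assignments]

open Classical in
/-- Decomposition of the sum of all full weights by the component on one edge. -/
theorem sum_fullWeight_eq (p : E → Momentum) (e : E) (s : Bool) :
    ∑ f with K.IsAssignment f, K.fullWeight f p =
      K.scalarNumerator e p + (-(K.fermionNumerator e s p *
        slash (dartMomentum p (e, !s))).trace + ((p e ⬝ᵥ p e : ℝ) : ℂ) * K.numerator e p) := by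
  have h : ∀ c, (Finset.univ.filter fun f => K.IsAssignment f).filter (fun f => f e = c) =
      K.assignments e c := fun c => by
    ext f
    simp [mem_assignments]
  rw [← Finset.sum_fiberwise _ (fun f => f e), sum_component, h, h, h]
  congr 1
  · exact Finset.sum_congr rfl fun f hf => fullWeight_of_scalar (mem_assignments.1 hf).1
      (mem_assignments.1 hf).2
  congr 1
  · rw [fermionNumerator, Finset.sum_mul, Matrix.trace_sum, ← Finset.sum_neg_distrib]
    refine Finset.sum_congr rfl fun f hf => ?_
    rw [fullWeight_of_fermion (mem_assignments.1 hf).1 (mem_assignments.1 hf).2 s]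
    simp
  · rw [numerator, Finset.mul_sum]
    exact Finset.sum_congr rfl fun f hf => fullWeight_of_auxiliary (mem_assignments.1 hf).1
      (mem_assignments.1 hf).2

section Update

variable {p' : E → Momentum} {e : E} (h : ∀ e', e' ≠ e → p e' = p' e')
include h

theorem numerator_congr : K.numerator e p = K.numerator e p' :=
  Finset.sum_congr rfl fun _ hf => weight_congr (mem_assignments.1 hf).1 h

theorem scalarNumerator_congr : K.scalarNumerator e p = K.scalarNumerator e p' :=
  Finset.sum_congr rfl fun _ hf => weight_congr (mem_assignments.1 hf).1 h

theorem fermionNumerator_congr (s : Bool) :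
    K.fermionNumerator e s p = K.fermionNumerator e s p' :=
  Finset.sum_congr rfl fun f hf => by
    rw [weight_congr (mem_assignments.1 hf).1 h,
      openLine_congr (mem_assignments.1 hf).1 (mem_assignments.1 hf).2 s h]

end Update

theorem proj_mul_fermionNumerator (e : E) (s : Bool) :
    proj s * K.fermionNumerator e s p = K.fermionNumerator e s p := by
  rw [fermionNumerator, Finset.mul_sum]
  refine Finset.sum_congr rfl fun f _ => ?_
  rw [Matrix.mul_smul, proj_mul_openLine]

theorem fermionNumerator_mul_proj (e : E) (s : Bool) :
    K.fermionNumerator e s p * proj (!s) = K.fermionNumerator e s p := by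
  rw [fermionNumerator, Finset.sum_mul]
  refine Finset.sum_congr rfl fun f hf => ?_
  rw [Matrix.smul_mul, (mem_assignments.1 hf).1.openLine_mul_proj (mem_assignments.1 hf).2]

open Classical in
/-- For conserved momenta, the three two-point functions are given by one block cofactor. -/
theorem IsFlow.numerators_eq [Fintype V] (e₀ : K.Side true ≃ K.Side false) (hp : K.IsFlow p)
    (e : E) (a b : K.Side true) :
    K.numerator e p = (diracMatrix e₀ p + singleBlock a b 1).det ∧
    K.scalarNumerator e p = ((p e ⬝ᵥ p e : ℝ) : ℂ) * K.numerator e p ∧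
    ∀ s, K.fermionNumerator e s p =
      K.numerator e p • (proj s * slash (dartMomentum p (e, !s))) := by
  set M := (diracMatrix e₀ p + singleBlock a b 1).det with hM
  -- The momentum on `e` is replaced by an arbitrary X. The left side sorts the determinant by the
  -- field on `e`, the right side is the block cofactor formula; coefficients in X are compared
  -- below.
  have key : ∀ s X, K.scalarNumerator e p + (-(K.fermionNumerator e s p *
      slash (if !s then X else -X)).trace + ((X ⬝ᵥ X : ℝ) : ℂ) * K.numerator e p) =
      (((X - p e) ⬝ᵥ (X - p e) : ℝ) : ℂ) * M := by
    intro s X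
    have hX : ∀ e', e' ≠ e → p e' = Function.update p e X e' := fun e' he' => by simp [he']
    have h1 := sum_fullWeight_eq (K := K) (Function.update p e X) e s
    rw [sum_fullWeight_eq_det e₀, hp.det_update e₀ e X a b, ← numerator_congr hX,
      ← scalarNumerator_congr hX, ← fermionNumerator_congr hX] at h1
    simp only [dartMomentum, Function.update_self] at h1
    exact h1.symm
  have hS : K.scalarNumerator e p = ((p e ⬝ᵥ p e : ℝ) : ℂ) * M := by
    have := key true 0
    simpa [slash] using this
  have hN : K.numerator e p = M := by
    -- Averaging over X and -X removes the fermionic and all other linear terms; a unit vector then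
    -- isolates the coefficient of X².
    have h1 := key false (Pi.single 0 1)
    have h2 := key false (-Pi.single 0 1)
    simp only [Bool.not_false, if_true, slash_neg, mul_neg, Matrix.trace_neg, hS, sub_dotProduct,
      dotProduct_sub, neg_dotProduct, dotProduct_neg, dotProduct_single, single_dotProduct] at h1 h2
    push_cast at h1 h2
    simp at h1 h2
    linear_combination (1 / 2 : ℂ) * h1 + (1 / 2 : ℂ) * h2
  refine ⟨hN, by rw [hS, hN], fun s => ?_⟩
  rw [← sub_eq_zero]
  -- The part linear in X determines the fermion numerator, because both sides flip chirality in the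
  -- same way and the trace pairing is nondegenerate on such matrices.
  refine eq_zero_of_trace_mul_slash (s := s) ?_ ?_ fun Y => ?_
  · rw [Matrix.mul_sub, proj_mul_fermionNumerator, Matrix.mul_smul, ← Matrix.mul_assoc,
      proj_mul_self]
  · rw [Matrix.sub_mul, fermionNumerator_mul_proj, Matrix.smul_mul, Matrix.mul_assoc,
      ← proj_mul_slash, ← Matrix.mul_assoc, proj_mul_self]
  · have h1 := key s (if !s then Y else -Y)
    rw [Matrix.sub_mul, Matrix.trace_sub, Matrix.smul_mul, Matrix.trace_smul,
      trace_proj_slash_slash, hN]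
    rw [hS, hN] at h1
    cases s
    · simp [dartMomentum, sub_dotProduct, dotProduct_sub, dotProduct_comm Y] at h1 ⊢
      linear_combination -h1
    · simp [dartMomentum, sub_dotProduct, dotProduct_sub, dotProduct_comm Y] at h1 ⊢
      linear_combination -h1

end CompletedGraph

namespace CompletedGraph

variable {V E : Type*} [Fintype E] {K : CompletedGraph V E} {p k : E → Momentum}

/-! ### Power counting -/

open Classical in
/-- The vertices of chirality `s` in `W`. -/
noncomputable def sideIn (K : CompletedGraph V E) (W : Finset V) (s : Bool) : Finset V :=
  W.filter fun v => K.chirality v = s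

omit [Fintype E] in
theorem card_sideIn_add (W : Finset V) :
    (K.sideIn W true).card + (K.sideIn W false).card = W.card := by
  classical
  rw [sideIn, sideIn, ← Finset.card_filter_add_card_filter_not (s := W)
    fun v => K.chirality v = true]
  simp

open Classical in
theorem card_sideIn_mul_three (W : Finset V) (s : Bool) :
    (K.sideIn W s).card * 3 =
      (K.inner W).card + ((K.boundary W).filter fun e => K.ends s e ∈ W).card := by
  have h1 : (K.inner W).card + ((K.boundary W).filter fun e => K.ends s e ∈ W).card =
      (Finset.univ.filter fun e => K.ends s e ∈ W).card := by
    rw [← Finset.card_union_of_disjoint]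
    · congr 1
      ext e
      cases s <;> simp [inner, boundary] <;> tauto
    · rw [Finset.disjoint_left]
      intro e he he'
      simp [inner, boundary] at he he'
      tauto
  rw [h1, Finset.card_eq_sum_card_fiberwise (f := K.ends s) (t := K.sideIn W s), ← smul_eq_mul,
    ← Finset.sum_const]
  · refine Finset.sum_congr rfl fun v hv => ?_
    obtain ⟨hvW, hvs⟩ := Finset.mem_filter.1 hv
    rw [← K.card_incident v]
    congr 1
    ext e
    simp only [mem_incident, hvs, Finset.mem_filter, Finset.mem_univ, true_and]
    exact ⟨fun h => ⟨h ▸ hvW, h⟩, fun h => h.2⟩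
  · intro e he
    simp only [Finset.coe_filter, Finset.mem_univ, true_and, Set.mem_ofPred_eq] at he
    exact Finset.mem_coe.2 (Finset.mem_filter.2 ⟨he, K.chirality_ends s e⟩)

/-- In a vertex subgraph one of the two chiralities has one vertex less than the other, and
all external legs are attached to the latter. -/
theorem IsVertexSubgraph.exists_minority {W : Finset V} (hW : K.IsVertexSubgraph W) :
    ∃ s, (K.sideIn W s).Nonempty ∧ (K.inner W).card = 3 * (K.sideIn W s).card ∧
      W.card = 2 * (K.sideIn W s).card + 1 := by
  classical
  obtain ⟨h2, -, h3⟩ := hW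
  have ht := card_sideIn_mul_three (K := K) W true
  have hf := card_sideIn_mul_three (K := K) W false
  have hc := card_sideIn_add (K := K) W
  have hb : ((K.boundary W).filter fun e => K.ends true e ∈ W).card +
      ((K.boundary W).filter fun e => K.ends false e ∈ W).card = 3 := by
    rw [← h3, ← Finset.card_filter_add_card_filter_not (s := K.boundary W)
      fun e => K.ends true e ∈ W]
    congr 2
    refine Finset.filter_congr fun e he => ?_
    simp [boundary] at he
    tauto
  -- Three times the difference of the two vertex numbers is the difference of the numbers of legs,
  -- which is odd and at most 3 in absolute value, hence ±3: all legs sit on the majority side.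
  have : (K.sideIn W true).card < (K.sideIn W false).card ∨
    (K.sideIn W false).card < (K.sideIn W true).card := by omega
  rcases this with h | h
  · exact ⟨true, Finset.card_pos.1 (by omega), by omega, by omega⟩
  · exact ⟨false, Finset.card_pos.1 (by omega), by omega, by omega⟩

-- Loop momenta occur only in blocks with both vertices in W. The cofactor, whose position is free,
-- is taken at a vertex of W of chirality `s`, so that only the other such vertices contribute, two
-- powers each. Chiral vertices label rows, so for them the transposed matrix is used.
open Classical in
theorem loopDegreeLE_numerator [Fintype V] (e₀ : K.Side true ≃ K.Side false) {W : Finset V}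
    {s : Bool} (hs : (K.sideIn W s).Nonempty) (e : E) :
    K.LoopDegreeLE W (K.numerator e) (2 * ((K.sideIn W s).card - 1)) := by
  intro p k hp hk hkW
  obtain ⟨w, hw⟩ := hs
  obtain ⟨hwW, hws⟩ := Finset.mem_filter.1 hw
  have hpk : ∀ t : ℝ, K.IsFlow (p + t • k) := fun t v => by
    simp [Finset.sum_add_distrib, ← Finset.smul_sum, hp v, hk v]
  have hnum : ∀ (t : ℝ) (a b : K.Side true), K.numerator e (p + t • k) =
      (diracMatrix e₀ p + (t : ℂ) • diracMatrix e₀ k + singleBlock a b 1).det := fun t a b => by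
    rw [((hpk t).numerators_eq e₀ e a b).1, diracMatrix_add, diracMatrix_smul]
  have hsupp : ∀ r c, (r.1.1 ∉ W ∨ (e₀ c.1).1 ∉ W) → diracMatrix e₀ k r c = 0 := by
    intro r c hrc
    rw [diracMatrix, Matrix.of_apply]
    refine Finset.sum_eq_zero fun e' he' => ?_
    obtain ⟨h1, h2⟩ := (Finset.mem_filter.1 he').2
    rw [hkW e', quat_zero, Matrix.zero_apply]
    intro h3
    rw [colOf, Equiv.symm_apply_eq] at h2
    simp only [inner, Finset.mem_filter, Finset.mem_univ, true_and] at h3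
    rw [← h1, ← h2] at hrc
    exact hrc.elim (fun h => h h3.1) fun h => h h3.2
  cases s
  · let U : Finset (K.Side true) := Finset.univ.filter fun v => (e₀ v).1 ∈ W
    have hU : U.card = (K.sideIn W false).card := by
      refine Finset.card_bij (fun v _ => (e₀ v).1) ?_ ?_ ?_
      · exact fun v hv => Finset.mem_filter.2 ⟨(Finset.mem_filter.1 hv).2, (e₀ v).2⟩
      · exact fun v _ v' _ h => e₀.injective (Subtype.ext h)
      · intro v hv
        obtain ⟨h1, h2⟩ := Finset.mem_filter.1 hv
        exact ⟨e₀.symm ⟨v, h2⟩, by simp [U, h1], by simp⟩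
    obtain ⟨P, hP, hPe⟩ := exists_polynomial_det_add_singleBlock (hp.sum_row e₀) (hk.sum_row e₀)
      (K.endOf true e) (b := e₀.symm ⟨w, hws⟩) (U := U) (by simp [U, hwW])
      fun r c hc => hsupp r c (Or.inr (by simpa [U] using hc))
    refine ⟨P, ?_, fun t => ?_⟩
    · rwa [hU, Fintype.card_fin] at hP
    · rw [hPe, hnum t]
  · let U : Finset (K.Side true) := Finset.univ.filter fun v => v.1 ∈ W
    have hU : U.card = (K.sideIn W true).card := by
      refine Finset.card_bij (fun v _ => v.1) ?_ ?_ ?_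
      · exact fun v hv => Finset.mem_filter.2 ⟨(Finset.mem_filter.1 hv).2, v.2⟩
      · exact fun v _ v' _ h => Subtype.ext h
      · intro v hv
        obtain ⟨h1, h2⟩ := Finset.mem_filter.1 hv
        exact ⟨⟨v, h2⟩, by simp [U, h1], rfl⟩
    obtain ⟨P, hP, hPe⟩ := exists_polynomial_det_add_singleBlock
      (A := (diracMatrix e₀ p)ᵀ) (B := (diracMatrix e₀ k)ᵀ) (hp.sum_col e₀) (hk.sum_col e₀)
      (K.endOf true e) (b := ⟨w, hws⟩) (U := U) (by simp [U, hwW])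
      fun r c hc => hsupp c r (Or.inl (by simpa [U] using hc))
    refine ⟨P, ?_, fun t => ?_⟩
    · rwa [hU, Fintype.card_fin] at hP
    · rw [hPe, hnum t ⟨w, hws⟩ (K.endOf true e), ← Matrix.det_transpose]
      simp [singleBlock_transpose]

/-- With n minority vertices there are 3n edges, 2n + 1 vertices and n loops, and 4n + 2(n - 1) - 6n
= -2. -/
theorem isUVConvergent_numerator [Fintype V] (e₀ : K.Side true ≃ K.Side false) {W : Finset V}
    (hW : K.IsVertexSubgraph W) (e : E) : K.IsUVConvergent W (K.numerator e) := by
  obtain ⟨s, hs, h1, h2⟩ := hW.exists_minority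
  have hpos := Finset.card_pos.2 hs
  refine ⟨_, loopDegreeLE_numerator e₀ hs e, ?_⟩
  rw [loopNumber]
  omega

theorem finite_vertices (K : CompletedGraph V E) : Finite V := by
  have : Function.Surjective fun x : Bool × E => K.ends x.1 x.2 := fun v => by
    have h : 0 < (K.incident v).card := by
      rw [K.card_incident]
      norm_num
    obtain ⟨e, he⟩ := Finset.card_pos.1 h
    exact ⟨(K.chirality v, e), K.mem_incident.1 he⟩
  exact Finite.of_surjective _ this

theorem nonempty_side_equiv [Fintype V] : Nonempty (K.Side true ≃ K.Side false) := by
  refine Fintype.card_eq.1 (Nat.eq_of_mul_eq_mul_right three_pos ?_)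
  rw [card_side_mul_three, card_side_mul_three]

end CompletedGraph

end WessZumino

theorem mainTheorem4 {V E : Type*} [Fintype E] (K : WessZumino.CompletedGraph V E) :
    (∀ p : E → WessZumino.Momentum, K.IsFlow p →
      ∀ e e' : E, K.numerator e p = K.numerator e' p) ∧
    (∀ W : Finset V, K.IsVertexSubgraph W → ∀ e : E, K.IsUVConvergent W (K.numerator e)) ∧
    (∀ p : E → WessZumino.Momentum, K.IsFlow p → ∀ e : E,
      K.scalarNumerator e p = ((p e ⬝ᵥ p e : ℝ) : ℂ) * K.numerator e p ∧
      ∀ s : Bool, K.fermionNumerator e s p =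
        K.numerator e p •
          (WessZumino.proj s * WessZumino.slash
            (WessZumino.CompletedGraph.dartMomentum p (e, !s)))) := by
  have := K.finite_vertices
  have := Fintype.ofFinite V
  obtain ⟨e₀⟩ := WessZumino.CompletedGraph.nonempty_side_equiv (K := K)
  refine ⟨fun p hp e e' => ?_, fun W hW e => ?_, fun p hp e => ?_⟩
  -- Both numerators are compared with the cofactor at one and the same block.
  · rw [(hp.numerators_eq e₀ e (K.endOf true e) (K.endOf true e)).1,
      (hp.numerators_eq e₀ e' (K.endOf true e) (K.endOf true e)).1]
  · exact WessZumino.CompletedGraph.isUVConvergent_numerator e₀ hW e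
  · exact (hp.numerators_eq e₀ e (K.endOf true e) (K.endOf true e)).2
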